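/- Let $q$ be a prime power. Identify the points of the line $\ell_\infty\colon z=0$ of $\mathrm{PG}(2,q^3)$ with the planes of a regular 2-spread of $\mathrm{PG}(5,q)$ by the Bruck–Bose correspondence: fix an $\mathbb F_q$-linear isomorphism $\varepsilon\colon \mathbb F_{q^3}^2\to\mathbb F_q^6$, and let the point $L=(\alpha,\beta,0)$ correspond to the plane $[L]=\{\varepsilon(\alpha x,\beta x) : x\in\mathbb F_{q^3}\}$. Let $\pi$ be an order-$q$-subplane of $\mathrm{PG}(2,q^3)$ (the image of $\mathrm{PG}(2,q)$ under an element of $\mathrm{PGL}(3,q^3)$) with no point on $\ell_\infty$, and let $\mathbb S$ be its exterior splash: the set of planes $[L]$ with $L$ a point of $\ell_\infty$ on an extended line of $\pi$. A cover of $\mathbb S$ is a set of $q^2+q+1$ pairwise disjoint planes of $\mathrm{PG}(5,q)$ that cover the same points as the planes of $\mathbb S$ and each meet every plane of $\mathbb S$ in exactly one point. A tangent cover (with respect to $\pi$) is a cover $\mathbb T$ such that for each point $P$ of $\pi$, the tangent plane at $P$ to the set of affine points of $\mathrm{PG}(6,q)$ representing $\pi$ (the plane containing the tangent lines at $P$ to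 the twisted cubics that represent the lines of $\pi$ through $P$) meets the hyperplane at infinity $\mathrm{PG}(5,q)$ in a line contained in a plane of $\mathbb T$. A conic cover is a cover that is not a tangent cover. Then $\mathbb S$ has exactly two covers, one tangent cover $\mathbb T$ and one conic cover $\mathbb C$. Moreover, in the cubic extension $\mathrm{PG}(5,q^3)$, where $X\mapsto X^q$ raises all coordinates to the power $q$: 1. There are exactly three lines of $\mathrm{PG}(5,q^3)$ that meet the extension of every plane of $\mathbb T$ (transversal lines of $\mathbb T$). They are of the form $g_{\mathbb T},g_{\mathbb T}^q,g_{\mathbb T}^{q^2}$, and none of them contains a point of $\mathrm{PG}(5,q)$. Moreover, $\mathbb T$ is contained in a unique regular 2-spread of $\mathrm{PG}(5,q)$. 2. There are exactly three transversal lines of $\mathbb C$. They are of the form $g_{\mathbb C},g_{\mathbb C}^q,g_{\mathbb C}^{q^2}$, and none of them contains a point of $\mathrm{PG}(5,q)$. Moreover, $\mathbb C$ is contained in a unique regular 2-spread of $\mathrm{PG}(5,q)$. Here a 2-spread is a set of planes partitioning the points of $\mathrm{PG}(5,q)$; a 2-regulus is a set of $q+1$ pairwise disjoint planes such that a line meeting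 three of them meets all of them; and a 2-spread is regular if for any three of its planes it contains the 2-regulus containing them. -/

import Mathlib

open scoped LinearAlgebra.Projectivization

section Subspaces

variable {k V : Type*} [Field k] [AddCommGroup V] [Module k V]

/-- A line of the projective space of `V`: a vector subspace of dimension 2. -/
def IsProjLine (U : Submodule k V) : Prop := Module.finrank k U = 2

/-- A plane of the projective space of `V`: a vector subspace of dimension 3. -/
def IsProjPlane (U : Submodule k V) : Prop := Module.finrank k U = 3

/-- Two subspaces meet when they have a projective point in common. -/
def Meets (U W : Submodule k V) : Prop := U ⊓ W ≠ ⊥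

end Subspaces

section Spreads

variable {F : Type*} [Field F]

/-- A 2-spread of `PG(5,q)`: a set of planes that partition the points. -/
def IsTwoSpread (𝒮 : Set (Submodule F (Fin 6 → F))) : Prop :=
  (∀ U ∈ 𝒮, IsProjPlane U) ∧ ∀ v : Fin 6 → F, v ≠ 0 → ∃! U, U ∈ 𝒮 ∧ v ∈ U

/-- A 2-regulus of `PG(5,q)`: a set of `q + 1` mutually disjoint planes such that a line that
meets three of them meets all of them. -/
def IsTwoRegulus (R : Set (Submodule F (Fin 6 → F))) : Prop :=
  R.ncard = Nat.card F + 1 ∧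
  (∀ U ∈ R, IsProjPlane U) ∧
  (∀ U ∈ R, ∀ W ∈ R, U ≠ W → ¬ Meets U W) ∧
  ∀ l : Submodule F (Fin 6 → F), IsProjLine l →
    (∃ A ∈ R, ∃ B ∈ R, ∃ C ∈ R, A ≠ B ∧ A ≠ C ∧ B ≠ C ∧ Meets l A ∧ Meets l B ∧ Meets l C) →
    ∀ D ∈ R, Meets l D

/-- A 2-spread is regular when it contains the 2-regulus through any three of its planes. -/
def IsRegularTwoSpread (𝒮 : Set (Submodule F (Fin 6 → F))) : Prop :=
  IsTwoSpread 𝒮 ∧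
  ∀ A ∈ 𝒮, ∀ B ∈ 𝒮, ∀ C ∈ 𝒮, A ≠ B → A ≠ C → B ≠ C →
    ∀ R, IsTwoRegulus R → A ∈ R → B ∈ R → C ∈ R → R ⊆ 𝒮

/-- `X` is a cover (switching set) of the set `S` of planes: `X` consists of `q ^ 2 + q + 1`
mutually disjoint planes, the planes of `X` and those of `S` cover the same points, and each plane
of `X` meets each plane of `S` in exactly one point. -/
def IsCover (S X : Set (Submodule F (Fin 6 → F))) : Prop :=
  X.ncard = Nat.card F ^ 2 + Nat.card F + 1 ∧
  (∀ U ∈ X, IsProjPlane U) ∧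
  (∀ U ∈ X, ∀ W ∈ X, U ≠ W → ¬ Meets U W) ∧
  (∀ v : Fin 6 → F, v ≠ 0 → ((∃ U ∈ S, v ∈ U) ↔ ∃ U ∈ X, v ∈ U)) ∧
  ∀ U ∈ S, ∀ W ∈ X, Module.finrank F (U ⊓ W : Submodule F (Fin 6 → F)) = 1

end Spreads

section Extension

variable {F : Type*} (K : Type*) [Field F] [Field K] [Algebra F K]

/-- A vector over `F` read as a vector over `K`. -/
def extVec {n : ℕ} (v : Fin n → F) : Fin n → K := fun i => algebraMap F K (v i)

/-- The extension `U*` to `PG(5,q³)` of a subspace `U` of `PG(5,q)`. -/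
def extSubspace (U : Submodule F (Fin 6 → F)) : Submodule K (Fin 6 → K) :=
  Submodule.span K (extVec K '' (U : Set (Fin 6 → F)))

variable (F) {K}

/-- The conjugate `W^q` of a subspace `W` of `PG(5,q³)`: its points are obtained from those of `W`
by raising all the coordinates to the power `q`. -/
def conjSubspace (W : Submodule K (Fin 6 → K)) : Submodule K (Fin 6 → K) :=
  Submodule.span K ((fun w i => w i ^ Nat.card F) '' (W : Set (Fin 6 → K)))

variable {F}

/-- A transversal line, in `PG(5,q³)`, of a set `X` of planes of `PG(5,q)`: a line that meets the
extension of every plane of `X`. -/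
def IsTransversalLine (X : Set (Submodule F (Fin 6 → F))) (g : Submodule K (Fin 6 → K)) : Prop :=
  IsProjLine g ∧ ∀ U ∈ X, Meets g (extSubspace K U)

/-- A subspace of `PG(5,q³)` that contains no point of `PG(5,q)`. -/
def DisjointFromBase (F : Type*) {K : Type*} [Field F] [Field K] [Algebra F K]
    (g : Submodule K (Fin 6 → K)) : Prop :=
  ∀ v : Fin 6 → F, v ≠ 0 → extVec K v ∉ g

/-- `X` has exactly three transversal lines; they form a conjugate triple `g, g^q, g^(q²)`, and
none of them contains a point of `PG(5,q)`. -/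
def HasExactlyThreeConjTransversals (K : Type*) [Field K] [Algebra F K]
    (X : Set (Submodule F (Fin 6 → F))) : Prop :=
  ∃ g : Submodule K (Fin 6 → K),
    {l : Submodule K (Fin 6 → K) | IsTransversalLine X l} =
      {g, conjSubspace F g, conjSubspace F (conjSubspace F g)} ∧
    g ≠ conjSubspace F g ∧ g ≠ conjSubspace F (conjSubspace F g) ∧
    conjSubspace F g ≠ conjSubspace F (conjSubspace F g) ∧
    DisjointFromBase F g ∧ DisjointFromBase F (conjSubspace F g) ∧
    DisjointFromBase F (conjSubspace F (conjSubspace F g))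

end Extension

section Splash

variable (F : Type*) {K : Type*} [Field F] [Field K] [Algebra F K]

/-- The order-`q`-subplane of `PG(2,q³)` that is the image of `PG(2,q)` under the homography with
matrix `A`: its points are those spanned by `A u` with `u` a nonzero vector over `F`. -/
def subplane (A : GL (Fin 3) K) : Set (ℙ K (Fin 3 → K)) :=
  {P | ∃ u : Fin 3 → F, u ≠ 0 ∧ (A : Matrix (Fin 3) (Fin 3) K).mulVec (extVec K u) ∈ P.submodule}

variable {F}

/-- The point `P` lies on the line at infinity, which has equation `z = 0`. -/
def OnInfinity (P : ℙ K (Fin 3 → K)) : Prop := ∀ x ∈ P.submodule, x 2 = 0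

/-- A set of points is exterior to the line at infinity when no point of it is on that line. -/
def IsExterior (π : Set (ℙ K (Fin 3 → K))) : Prop := ∀ P ∈ π, ¬ OnInfinity P

/-- The splash of `π`: the points at infinity on some line of `PG(2,q³)` that joins two distinct
points of `π`. -/
def splash (π : Set (ℙ K (Fin 3 → K))) : Set (ℙ K (Fin 3 → K)) :=
  {L | OnInfinity L ∧ ∃ P ∈ π, ∃ Q ∈ π, P ≠ Q ∧ L.submodule ≤ P.submodule ⊔ Q.submodule}

/-- The map `(α, β) ↦ (α, β, 0)`. -/
def atInfinity (K : Type*) [Field K] : (K × K) →ₗ[K] (Fin 3 → K) where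
  toFun p := ![p.1, p.2, 0]
  map_add' p r := by
    ext i
    fin_cases i <;> simp
  map_smul' c p := by
    ext i
    fin_cases i <;> simp

/-- The Bruck-Bose correspondence at infinity, with respect to a choice `ε` of coordinates over `F`
on `K × K`: to a point `L` of the line at infinity of `PG(2,q³)` corresponds the plane
`[L] = {ε (α, β) : (α, β, 0) ∈ L}` of `PG(5,q)`. As `L` varies these planes form a regular
2-spread. -/
def spreadPlane (ε : (K × K) ≃ₗ[F] (Fin 6 → F)) (L : ℙ K (Fin 3 → K)) :
    Submodule F (Fin 6 → F) :=
  ((L.submodule.comap (atInfinity K)).restrictScalars F).map (ε : (K × K) →ₗ[F] (Fin 6 → F))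

/-- The splash of `π` as a set of planes of `PG(5,q)`. -/
def splashPlanes (ε : (K × K) ≃ₗ[F] (Fin 6 → F)) (π : Set (ℙ K (Fin 3 → K))) :
    Set (Submodule F (Fin 6 → F)) :=
  spreadPlane ε '' splash π

/-- Let `a = A u` and `b = A v`. The line of `subplane F A` that joins the points `a` and `b`
has the affine parametrization
`s ↦ ((a₀ + s b₀) / (a₂ + s b₂), (a₁ + s b₁) / (a₂ + s b₂))`, which in `PG(6,q)` is a twisted cubic.
This is the derivative of the parametrization at `s = 0`, so `ε` of it is the point at infinity
of the tangent at `a` to that twisted cubic (for `b ≠ a` as points). -/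
def tangentDirection (A : GL (Fin 3) K) (u v : Fin 3 → F) : K × K :=
  let a := (A : Matrix (Fin 3) (Fin 3) K).mulVec (extVec K u)
  let b := (A : Matrix (Fin 3) (Fin 3) K).mulVec (extVec K v)
  ((b 0 * a 2 - a 0 * b 2) / a 2 ^ 2, (b 1 * a 2 - a 1 * b 2) / a 2 ^ 2)

/-- `T` is a cover of the splash of `π = subplane F A` such that, for every point `P` of `π`, the
tangent plane at `P` of `π` in `PG(6,q)` meets the hyperplane at infinity inside a plane of `T`. -/
def IsTangentCover (ε : (K × K) ≃ₗ[F] (Fin 6 → F)) (A : GL (Fin 3) K)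
    (T : Set (Submodule F (Fin 6 → F))) : Prop :=
  IsCover (splashPlanes ε (subplane F A)) T ∧
  ∀ u : Fin 3 → F, u ≠ 0 → ∃ U ∈ T, ∀ v : Fin 3 → F, ε (tangentDirection A u v) ∈ U

/-- The conic cover is the cover of the splash other than the tangent cover. -/
def IsConicCover (ε : (K × K) ≃ₗ[F] (Fin 6 → F)) (A : GL (Fin 3) K)
    (C : Set (Submodule F (Fin 6 → F))) : Prop :=
  IsCover (splashPlanes ε (subplane F A)) C ∧ ¬ IsTangentCover ε A C

end Splash

-- Write `x ^ q` for Frobenius and `N` for the norm of `K` over `F`. Since `π` has no point at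
-- infinity, its last coordinate identifies `F³` with `K`. The other two coordinates are then
-- combinations of `t`, `t^q`, `t^(q²)`, and a homography fixing the line at infinity turns `π` into
-- the points `(t^q, t^(q²), t)`. The line joining the points with parameters `s` and `t` meets
-- infinity, up to a linear change of coordinates, in `(w, w^(q²))` with `w = s^q t - t^q s`. The
-- quotient `w^(q²) / w` takes exactly the values of norm 1, so the splash is the family of planes
-- `y = m x` with `N(m) = 1` (`exists_normal_form`).
--
-- The points covered by this family are those with `x ≠ 0` and `N(x) = N(y)`, a condition unchanged
-- when Frobenius is applied to `y`. Hence the planes `y = (n x)^q` and the planes `y = (n x)^(q²)`,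
-- with `N(n) = 1`, form two covers; Hilbert 90 gives the one-point intersections (`isCover_twist`).
-- Conversely, a plane of a cover is the graph of an `F`-linear map `a x + b x^q + c x^(q²)` that
-- preserves the norm and whose quotient by `x` permutes the norm 1 group. Summing over that group,
-- whose order is 1 in `K`, kills all coefficients but one of `b`, `c`
-- (`frob_expansion_of_permutes`). Planes of the two families always meet, so a cover cannot mix
-- them (`isCover_normPlanes_iff`).
--
-- The tangent directions at `t` are `(w / t², w^(q²) / t²)` with `s` varying. They lie in one plane
-- of the `q²`-twisted family but not in one plane of the `q`-twisted family, which tells the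
-- tangent cover from the conic cover.
--
-- Both covers are norm families in twisted coordinates, so transversals and regular spreads are
-- studied once, for `normPlanes e`. Over `K`, conjugate coordinates turn the planes into `Y i =
-- m^(q^i) X i`. The three coordinate lines are transversal, and a polynomial of degree at most `q +
-- 1` with `q² + q + 1` roots shows that there are no others (`eq_coordLine_of_isTransversalLine`).
-- A regular spread containing the family must contain the plane `x = 0`; it is then closed under
-- affine lines over `F` in the parameter `m`, hence contains the whole Desarguesian spread. The
-- case `q = 2` is treated by counting points (`desarguesianSpread_subset`).

-- Frobenius, norm and Hilbert 90 in a cubic extension of finite fields.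

section Frobenius

/-- The relative Frobenius automorphism `x ↦ x ^ q` of an extension of a field with `q` elements. -/
noncomputable def frob (F : Type*) {K : Type*} [Field F] [Finite F] [Field K] [Algebra F K] :
    K →ₐ[F] K :=
  let _ := Fintype.ofFinite F
  FiniteField.frobeniusAlgHom F K

variable {F K : Type*} [Field F] [Finite F] [Field K] [Algebra F K]

theorem frob_apply (x : K) : frob F x = x ^ Nat.card F := by
  let _ := Fintype.ofFinite F
  simp [frob, Nat.card_eq_fintype_card]

theorem finite_cubic (hK : Module.finrank F K = 3) : Finite K := by
  have : Module.Finite F K := Module.finite_of_finrank_pos (by omega)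
  exact Module.finite_of_finite F

omit [Finite F] in
theorem card_cubic (hK : Module.finrank F K = 3) : Nat.card K = Nat.card F ^ 3 := by
  have : Module.Finite F K := Module.finite_of_finrank_pos (by omega)
  rw [← hK]
  exact Module.natCard_eq_pow_finrank

theorem frob_frob_frob (hK : Module.finrank F K = 3) (x : K) :
    frob F (frob F (frob F x)) = x := by
  have := finite_cubic hK
  let _ := Fintype.ofFinite K
  rw [frob_apply, frob_apply, frob_apply, ← pow_mul, ← pow_mul]
  have h : Nat.card F * (Nat.card F * Nat.card F) = Fintype.card K := by
    rw [← Nat.card_eq_fintype_card, card_cubic hK]; ring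
  rw [h, FiniteField.pow_card]

theorem one_lt_card (F : Type*) [Field F] [Finite F] : 1 < Nat.card F := Finite.one_lt_card

/-- Independence of the powers of the Frobenius automorphism of a cubic extension. -/
theorem frob_independent (hK : Module.finrank F K = 3) {a b c : K}
    (h : ∀ x : K, a * x + b * frob F x + c * frob F (frob F x) = 0) : a = 0 ∧ b = 0 ∧ c = 0 := by
  have := finite_cubic hK
  let _ := Fintype.ofFinite K
  have hq := one_lt_card F
  set q := Nat.card F with hqdef
  have hqq : q < q * q := by nlinarith
  -- The exponents `1`, `q`, `q²` are distinct and less than `q³ = |K|`, so a polynomial vanishing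
  -- on all of `K` has zero coefficients.
  let p : Polynomial K := Polynomial.C a * Polynomial.X + Polynomial.C b * Polynomial.X ^ q +
    Polynomial.C c * Polynomial.X ^ (q * q)
  have hdeg : p.natDegree ≤ q * q := by
    have h1 : (Polynomial.C a * Polynomial.X : Polynomial K).natDegree ≤ q * q :=
      (Polynomial.natDegree_C_mul_le a Polynomial.X |>.trans Polynomial.natDegree_X_le).trans (by omega)
    have h2 := (Polynomial.natDegree_C_mul_X_pow_le b q).trans hqq.le
    have h3 := Polynomial.natDegree_C_mul_X_pow_le c (q * q)
    exact Polynomial.natDegree_add_le_of_degree_le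
      (Polynomial.natDegree_add_le_of_degree_le h1 h2) h3
  have hp : p = 0 := by
    refine Polynomial.eq_zero_of_natDegree_lt_card_of_eval_eq_zero p (f := fun x : K => x)
      (fun _ _ hxy => hxy) (fun x => ?_) ?_
    · have := h x
      simp only [frob_apply, ← pow_mul] at this
      simpa [p] using this
    · rw [← Nat.card_eq_fintype_card, card_cubic hK]
      refine hdeg.trans_lt ?_
      rw [← hqdef]
      nlinarith [Nat.mul_lt_mul_of_pos_right hqq (show 0 < q by omega)]
  have hc (n : ℕ) : p.coeff n = 0 := by rw [hp]; simp
  have h1 := hc 1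
  have h2 := hc q
  have h3 := hc (q * q)
  simp only [p, Polynomial.coeff_add, Polynomial.coeff_C_mul, Polynomial.coeff_X_pow,
    Polynomial.coeff_X] at h1 h2 h3
  have e1 : 1 ≠ q := by omega
  have e2 : 1 ≠ q * q := by omega
  have e3 : q ≠ q * q := by omega
  rw [if_neg e1, if_neg e2] at h1
  rw [if_neg e1, if_neg e3] at h2
  rw [if_neg e2, if_neg e3.symm] at h3
  simp only [if_true, mul_one, mul_zero, add_zero, zero_add] at h1 h2 h3
  exact ⟨h1, h2, h3⟩

theorem frob_injective : Function.Injective (frob F : K → K) := (frob F : K →ₐ[F] K).injective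

theorem frob_ne_zero {x : K} (hx : x ≠ 0) : frob F x ≠ 0 :=
  (map_ne_zero_iff _ frob_injective).mpr hx

/-- Every `F`-linear endomorphism of a cubic extension is a combination of powers of Frobenius. -/
theorem exists_frob_expansion (hK : Module.finrank F K = 3) (f : K →ₗ[F] K) :
    ∃ a b c : K, ∀ x, f x = a * x + b * frob F x + c * frob F (frob F x) := by
  have : Module.Finite F K := Module.finite_of_finrank_pos (by omega)
  let g : (Fin 3 → K) →ₗ[K] (K →ₗ[F] K) :=
    { toFun := fun v => v 0 • LinearMap.id + v 1 • (frob F : K →ₐ[F] K).toLinearMap +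
        v 2 • ((frob F : K →ₐ[F] K).toLinearMap ∘ₗ (frob F : K →ₐ[F] K).toLinearMap)
      map_add' := fun v w => by ext x; simp; ring
      map_smul' := fun r v => by ext x; simp; ring }
  have hinj : Function.Injective g := by
    rw [← LinearMap.ker_eq_bot, LinearMap.ker_eq_bot']
    intro v hv
    have h := frob_independent (F := F) hK (a := v 0) (b := v 1) (c := v 2) (fun x => by
      have := LinearMap.congr_fun hv x
      simpa [g] using this)
    ext i
    fin_cases i
    · exact h.1
    · exact h.2.1
    · exact h.2.2
  have hsurj := (LinearMap.injective_iff_surjective_of_finrank_eq_finrank (f := g)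
    (by rw [Module.finrank_linearMap_self, hK]; simp)).mp hinj
  obtain ⟨v, hv⟩ := hsurj f
  refine ⟨v 0, v 1, v 2, fun x => ?_⟩
  rw [← hv]
  simp [g]

/-- The fixed field of Frobenius is the base field. -/
theorem exists_algebraMap_of_frob_eq {x : K} (hx : frob F x = x) : ∃ f : F, algebraMap F K f = x := by
  classical
  let _ := Fintype.ofFinite F
  by_contra! h
  have hinj := (algebraMap F K).injective
  let p : Polynomial K := Polynomial.X ^ Nat.card F - Polynomial.X
  have hdeg : p.natDegree = Nat.card F :=
    FiniteField.X_pow_card_sub_X_natDegree_eq K (one_lt_card F)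
  have hp : p = 0 := by
    -- An extra fixed element would give `X^q - X` a total of `q + 1` roots.
    refine Polynomial.eq_zero_of_natDegree_lt_card_of_eval_eq_zero' p
      (insert x (Finset.univ.image (algebraMap F K))) (fun y hy => ?_) ?_
    · rw [Finset.mem_insert, Finset.mem_image] at hy
      have : frob F y = y := by
        rcases hy with rfl | ⟨f, -, rfl⟩
        · exact hx
        · exact (frob F).commutes f
      rw [frob_apply] at this
      simp only [p, Polynomial.eval_sub, Polynomial.eval_pow, Polynomial.eval_X, this, sub_self]
    · rw [Finset.card_insert_of_notMem (by simpa using h), Finset.card_image_of_injective _ hinj,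
        hdeg, Finset.card_univ, Nat.card_eq_fintype_card]
      omega
  exact FiniteField.X_pow_card_sub_X_ne_zero K (one_lt_card F) hp

variable (F) in
/-- The norm of a cubic extension of finite fields. -/
noncomputable def cubicNorm (x : K) : K := x * frob F x * frob F (frob F x)

theorem cubicNorm_mul (x y : K) : cubicNorm F (x * y) = cubicNorm F x * cubicNorm F y := by
  simp only [cubicNorm, map_mul]; ring

theorem cubicNorm_inv (x : K) : cubicNorm F x⁻¹ = (cubicNorm F x)⁻¹ := by
  simp only [cubicNorm, map_inv₀, mul_inv]

theorem cubicNorm_div (x y : K) : cubicNorm F (x / y) = cubicNorm F x / cubicNorm F y := by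
  rw [div_eq_mul_inv, cubicNorm_mul, cubicNorm_inv, div_eq_mul_inv]

theorem cubicNorm_one : cubicNorm F (1 : K) = 1 := by simp [cubicNorm]

theorem cubicNorm_frob (hK : Module.finrank F K = 3) (x : K) :
    cubicNorm F (frob F x) = cubicNorm F x := by
  simp only [cubicNorm, frob_frob_frob hK]; ring

theorem cubicNorm_ne_zero {x : K} (hx : x ≠ 0) : cubicNorm F x ≠ 0 :=
  mul_ne_zero (mul_ne_zero hx (frob_ne_zero hx)) (frob_ne_zero (frob_ne_zero hx))

theorem ne_zero_of_cubicNorm {x : K} (hx : cubicNorm F x = 1) : x ≠ 0 := by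
  rintro rfl
  simp [cubicNorm] at hx

theorem cubicNorm_eq_pow (x : K) : cubicNorm F x = x ^ (Nat.card F ^ 2 + Nat.card F + 1) := by
  simp only [cubicNorm, frob_apply]; ring

/-- Hilbert 90. -/
theorem exists_frob_eq_mul (hK : Module.finrank F K = 3) {m : K} (hm : cubicNorm F m = 1) :
    ∃ x : K, x ≠ 0 ∧ frob F x = m * x := by
  have hm0 := ne_zero_of_cubicNorm hm
  have hm1 : frob F m ≠ 0 := frob_ne_zero hm0
  have hm2 : frob F (frob F m) ≠ 0 := frob_ne_zero hm1
  -- The Lagrange resolvent: Frobenius multiplies it by `m` because `N(m) = 1`, and it is nonzero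
  -- for some `y` by independence of the powers of Frobenius.
  obtain ⟨y, hy⟩ : ∃ y : K, 1 * y + m⁻¹ * frob F y + (frob F m)⁻¹ * m⁻¹ * frob F (frob F y) ≠ 0 := by
    by_contra! h
    exact one_ne_zero (frob_independent hK h).1
  refine ⟨_, hy, ?_⟩
  simp only [map_add, map_mul, map_inv₀, map_one, frob_frob_frob hK]
  have : (frob F (frob F m)) = m⁻¹ * (frob F m)⁻¹ := by
    field_simp
    rw [← hm, cubicNorm]; ring
  rw [this]
  field_simp
  ring

variable (F K) in
/-- The number of elements of norm 1. -/
theorem ncard_cubicNorm_eq_one (hK : Module.finrank F K = 3) :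
    {m : K | cubicNorm F m = 1}.ncard = Nat.card F ^ 2 + Nat.card F + 1 := by
  have := finite_cubic hK
  set q := Nat.card F with hq
  have hq1 : 1 < q := one_lt_card F
  have hcard : Nat.card Kˣ = (q ^ 2 + q + 1) * (q - 1) := by
    rw [Nat.card_units, card_cubic hK, ← hq]
    obtain ⟨r, hr⟩ : ∃ r, q = r + 1 := ⟨q - 1, by omega⟩
    rw [hr]
    simp only [Nat.add_sub_cancel]
    have : (r + 1) ^ 3 = ((r + 1) ^ 2 + (r + 1) + 1) * r + 1 := by ring
    omega
  -- The norm is the power `q² + q + 1` on the cyclic group `Kˣ`, and this exponent divides the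
  -- order of the group.
  have h := IsCyclic.card_powMonoidHom_ker (G := Kˣ) (q ^ 2 + q + 1)
  rw [hcard, Nat.gcd_eq_right (Dvd.intro _ rfl)] at h
  rw [← h, ← Nat.card_coe_set_eq]
  refine Nat.card_congr
    { toFun := fun m => ⟨Units.mk0 m.1 (ne_zero_of_cubicNorm m.2), ?_⟩
      invFun := fun u => ⟨(u.1 : K), ?_⟩
      left_inv := fun m => rfl
      right_inv := fun u => by ext; rfl }
  · have := m.2
    rw [Set.mem_ofPred_eq, cubicNorm_eq_pow] at this
    rw [MonoidHom.mem_ker]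
    ext
    simpa using this
  · have := u.2
    rw [MonoidHom.mem_ker] at this
    rw [Set.mem_ofPred_eq, cubicNorm_eq_pow]
    have h2 := congrArg (Units.val) this
    simpa using h2

/-- A polynomial of degree at most `q + 1` that vanishes on the elements of norm 1 is zero. -/
theorem eq_zero_of_eval_cubicNorm (hK : Module.finrank F K = 3) {p : Polynomial K}
    (hp : p.natDegree ≤ Nat.card F + 1) (h : ∀ m : K, cubicNorm F m = 1 → p.eval m = 0) :
    p = 0 := by
  have := finite_cubic hK
  refine Polynomial.eq_zero_of_natDegree_lt_card_of_eval_eq_zero' p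
    (Set.toFinite {m : K | cubicNorm F m = 1}).toFinset (fun m hm => h m (by simpa using hm)) ?_
  rw [← Set.ncard_eq_toFinset_card, ncard_cubicNorm_eq_one F K hK]
  have := one_lt_card F
  nlinarith

end Frobenius

-- Planes representing points of `PG(1,q³)`, and the norm family.

section Lines

variable {F K : Type*} [Field F] [Field K] [Algebra F K]

theorem meets_iff {V : Type*} [AddCommGroup V] [Module F V] {U W : Submodule F V} :
    Meets U W ↔ ∃ v, v ≠ 0 ∧ v ∈ U ∧ v ∈ W := by
  rw [Meets, Submodule.ne_bot_iff]
  constructor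
  · rintro ⟨v, hv, h0⟩
    exact ⟨v, h0, hv⟩
  · rintro ⟨v, h0, hv⟩
    exact ⟨v, hv, h0⟩

/-- The plane of `PG(5,q)` that represents the point of `PG(1,q³)` spanned by `a`. -/
def kLine (e : (K × K) ≃ₗ[F] (Fin 6 → F)) (a : K × K) : Submodule F (Fin 6 → F) :=
  ((Submodule.span K {a}).restrictScalars F).map (e : (K × K) →ₗ[F] (Fin 6 → F))

variable {e : (K × K) ≃ₗ[F] (Fin 6 → F)}

theorem mem_kLine {a : K × K} {v : Fin 6 → F} : v ∈ kLine e a ↔ ∃ x : K, e (x • a) = v := by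
  simp only [kLine, Submodule.mem_map, Submodule.restrictScalars_mem,
    Submodule.mem_span_singleton]
  constructor
  · rintro ⟨_, ⟨x, rfl⟩, h⟩
    exact ⟨x, h⟩
  · rintro ⟨x, h⟩
    exact ⟨_, ⟨x, rfl⟩, h⟩

theorem smul_mem_kLine (a : K × K) (x : K) : e (x • a) ∈ kLine e a := mem_kLine.mpr ⟨x, rfl⟩

theorem apply_mem_kLine (a : K × K) : e a ∈ kLine e a := mem_kLine.mpr ⟨1, by simp⟩

theorem kLine_smul {x : K} (hx : x ≠ 0) (a : K × K) : kLine e (x • a) = kLine e a := by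
  rw [kLine, kLine, Submodule.span_singleton_smul_eq (IsUnit.mk0 x hx)]

theorem isProjPlane_kLine (hK : Module.finrank F K = 3) {a : K × K} (ha : a ≠ 0) :
    IsProjPlane (kLine e a) := by
  rw [IsProjPlane, kLine]
  have h := LinearEquiv.finrank_map_eq e ((Submodule.span K {a}).restrictScalars F)
  have h1 := Module.finrank_mul_finrank F K (Submodule.span K {a})
  rw [finrank_span_singleton ha, hK] at h1
  exact h.trans h1.symm

theorem exists_smul_of_mem_kLine {a : K × K} {v : Fin 6 → F} (hv : v ∈ kLine e a) (h0 : v ≠ 0) :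
    ∃ x : K, x ≠ 0 ∧ e (x • a) = v := by
  obtain ⟨x, rfl⟩ := mem_kLine.mp hv
  refine ⟨x, ?_, rfl⟩
  rintro rfl
  simp at h0

theorem kLine_eq_of_mem {a b : K × K} {v : Fin 6 → F} (h0 : v ≠ 0) (ha : v ∈ kLine e a)
    (hb : v ∈ kLine e b) : kLine e a = kLine e b := by
  obtain ⟨x, hx, rfl⟩ := exists_smul_of_mem_kLine ha h0
  obtain ⟨y, hy, h⟩ := exists_smul_of_mem_kLine hb h0
  rw [← kLine_smul hx, ← e.injective h, kLine_smul hy]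

theorem not_meets_kLine {a b : K × K} (h : kLine e a ≠ kLine e b) :
    ¬ Meets (kLine e a) (kLine e b) := by
  rw [meets_iff]
  rintro ⟨v, h0, ha, hb⟩
  exact h (kLine_eq_of_mem h0 ha hb)

theorem kLine_eq_iff {a b : K × K} (ha : a ≠ 0) :
    kLine e a = kLine e b ↔ ∃ x : K, x • b = a := by
  constructor
  · intro h
    have := apply_mem_kLine (e := e) a
    rw [h] at this
    obtain ⟨x, hx⟩ := mem_kLine.mp this
    exact ⟨x, e.injective hx⟩
  · rintro ⟨x, rfl⟩
    refine kLine_smul ?_ b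
    rintro rfl
    simp at ha

/-- Two points of `PG(1,q³)` are equal when the determinant of their coordinates vanishes. -/
theorem kLine_eq_iff_det {a b : K × K} (ha : a ≠ 0) (hb : b ≠ 0) :
    kLine e a = kLine e b ↔ a.1 * b.2 = a.2 * b.1 := by
  rw [kLine_eq_iff ha]
  constructor
  · rintro ⟨x, rfl⟩
    simp only [Prod.smul_fst, Prod.smul_snd, smul_eq_mul]
    ring
  · intro h
    by_cases h1 : b.1 = 0
    · have h2 : b.2 ≠ 0 := fun h2 => hb (Prod.ext h1 h2)
      have h3 : a.1 = 0 := by simpa [h1, h2] using h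
      refine ⟨a.2 / b.2, Prod.ext ?_ ?_⟩
      · simp [h1, h3]
      · simp [h2]
    · refine ⟨a.1 / b.1, Prod.ext ?_ ?_⟩
      · simp [h1]
      · simp only [Prod.smul_snd, smul_eq_mul]
        field_simp
        rw [h, mul_comm]

theorem mk_one_ne_zero (m : K) : ((1 : K), m) ≠ 0 := by
  simp [Prod.ext_iff]

theorem mk_zero_one_ne_zero : ((0 : K), (1 : K)) ≠ 0 := by
  simp [Prod.ext_iff]

theorem kLine_one_injective : Function.Injective (fun m : K => kLine e (1, m)) := by
  intro m n h
  have := (kLine_eq_iff_det (mk_one_ne_zero m) (mk_one_ne_zero n)).mp h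
  simpa using this.symm

theorem kLine_one_ne (m : K) : kLine e (1, m) ≠ kLine e (0, 1) := by
  intro h
  have := (kLine_eq_iff_det (mk_one_ne_zero m) mk_zero_one_ne_zero).mp h
  simp at this

theorem kLine_eq_normal_form {a : K × K} (ha : a ≠ 0) :
    kLine e a = kLine e (0, 1) ∨ ∃ m, kLine e a = kLine e (1, m) := by
  by_cases h : a.1 = 0
  · exact Or.inl ((kLine_eq_iff_det ha mk_zero_one_ne_zero).mpr (by simp [h]))
  · refine Or.inr ⟨a.2 / a.1, (kLine_eq_iff_det ha (mk_one_ne_zero _)).mpr ?_⟩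
    simp only
    field_simp

/-- The planes that represent the points `(1, m)` with `m` of norm 1. -/
def normPlanes [Finite F] (e : (K × K) ≃ₗ[F] (Fin 6 → F)) : Set (Submodule F (Fin 6 → F)) :=
  (fun m => kLine e (1, m)) '' {m : K | cubicNorm F m = 1}

theorem ncard_normPlanes [Finite F] (hK : Module.finrank F K = 3)
    (e : (K × K) ≃ₗ[F] (Fin 6 → F)) :
    (normPlanes e).ncard = Nat.card F ^ 2 + Nat.card F + 1 := by
  rw [normPlanes, Set.ncard_image_of_injective _ kLine_one_injective, ncard_cubicNorm_eq_one F K hK]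

theorem apply_mem_kLine_one {x y m : K} : e (x, y) ∈ kLine e (1, m) ↔ y = x * m := by
  rw [mem_kLine]
  constructor
  · rintro ⟨z, hz⟩
    have := e.injective hz
    simp only [Prod.smul_mk, smul_eq_mul, mul_one, Prod.mk.injEq] at this
    rw [← this.1, ← this.2]
  · rintro rfl
    exact ⟨x, by simp⟩

/-- The point set of the family depends on `y` only through its norm; this invariance under
Frobenius is what produces covers. -/
theorem exists_normPlanes_iff [Finite F] {x y : K} (h : (x, y) ≠ 0) :
    (∃ U ∈ normPlanes e, e (x, y) ∈ U) ↔ x ≠ 0 ∧ cubicNorm F x = cubicNorm F y := by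
  constructor
  · rintro ⟨_, ⟨m, hm, rfl⟩, hv⟩
    have hy := apply_mem_kLine_one.mp hv
    have hm' : cubicNorm F m = 1 := hm
    refine ⟨?_, ?_⟩
    · rintro rfl
      simp [hy] at h
    · rw [hy, cubicNorm_mul, hm', mul_one]
  · rintro ⟨hx, hn⟩
    refine ⟨_, ⟨y / x, ?_, rfl⟩, apply_mem_kLine_one.mpr ?_⟩
    · change cubicNorm F (y / x) = 1
      rw [cubicNorm_div, ← hn, div_self (cubicNorm_ne_zero hx)]
    · field_simp

end Lines

-- Conjugate coordinates over `K` and transversal lines.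

section ConjugateCoordinates

variable {F K : Type*} [Field F] [Finite F] [Field K] [Algebra F K]

theorem eq_span_pair_of_finrank {k V : Type*} [Field k] [AddCommGroup V] [Module k V]
    {l : Submodule k V} (hl : Module.finrank k l = 2) {v w : V} (hv : v ∈ l) (hw : w ∈ l)
    (h : LinearIndependent k ![v, w]) : l = Submodule.span k {v, w} := by
  have : FiniteDimensional k l := FiniteDimensional.of_finrank_pos (by omega)
  symm
  refine Submodule.eq_of_le_of_finrank_eq ?_ ?_
  · rw [Submodule.span_le]
    rintro u (rfl | rfl)
    · exact hv
    · exact hw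
  · have h1 := finrank_span_eq_card h
    rw [Matrix.range_cons, Matrix.range_cons, Matrix.range_empty, Set.union_empty,
      Set.singleton_union] at h1
    rw [h1, hl, Fintype.card_fin]

variable (F K) in
/-- The vector of the conjugates of an element of a cubic extension. -/
noncomputable def conjugates : K →ₗ[F] (Fin 3 → K) :=
  LinearMap.pi ![LinearMap.id, (frob F : K →ₐ[F] K).toLinearMap,
    (frob F : K →ₐ[F] K).toLinearMap ∘ₗ (frob F : K →ₐ[F] K).toLinearMap]

theorem conjugates_zero (x : K) : conjugates F K x 0 = x := rfl

theorem conjugates_one (x : K) : conjugates F K x 1 = frob F x := rfl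

theorem conjugates_two (x : K) : conjugates F K x 2 = frob F (frob F x) := rfl

theorem conjugates_succ (hK : Module.finrank F K = 3) (x : K) (i : Fin 3) :
    conjugates F K x (i + 1) = frob F (conjugates F K x i) := by
  fin_cases i
  · rfl
  · rfl
  · exact (frob_frob_frob hK x).symm

theorem conjugates_mul (x y : K) (i : Fin 3) :
    conjugates F K (x * y) i = conjugates F K x i * conjugates F K y i := by
  fin_cases i <;> simp [conjugates]

theorem conjugates_injective (i : Fin 3) {x y : K}
    (h : conjugates F K x i = conjugates F K y i) : x = y := by
  fin_cases i
  · exact h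
  · exact frob_injective h
  · exact frob_injective (frob_injective h)

theorem exists_conjugates_eq (hK : Module.finrank F K = 3) (i : Fin 3) {m : K}
    (hm : cubicNorm F m = 1) : ∃ n : K, cubicNorm F n = 1 ∧ conjugates F K n i = m := by
  fin_cases i
  · exact ⟨m, hm, rfl⟩
  · exact ⟨frob F (frob F m), by rw [cubicNorm_frob hK, cubicNorm_frob hK, hm],
      frob_frob_frob hK m⟩
  · exact ⟨frob F m, by rw [cubicNorm_frob hK, hm], frob_frob_frob hK m⟩

/-- A functional vanishing on all vectors of conjugates would be a linear relation between the
powers of Frobenius. -/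
theorem span_range_conjugates (hK : Module.finrank F K = 3) :
    Submodule.span K (Set.range (conjugates F K)) = ⊤ := by
  by_contra hne
  obtain ⟨f, hf0, hf⟩ := Submodule.exists_le_ker_of_lt_top _ (lt_top_iff_ne_top.mpr hne)
  have key := fun x : K => LinearMap.mem_ker.mp
    (hf (Submodule.subset_span (Set.mem_range_self (f := conjugates F K) x)))
  have h := frob_independent (F := F) hK (a := f (Pi.single 0 1)) (b := f (Pi.single 1 1))
    (c := f (Pi.single 2 1)) (fun x => by
      rw [← key x]
      conv_rhs => rw [pi_eq_sum_univ' (conjugates F K x)]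
      simp only [Fin.sum_univ_three, map_add, map_smul, smul_eq_mul, conjugates_zero,
        conjugates_one, conjugates_two]
      simp only [mul_comm])
  apply hf0
  ext i
  fin_cases i
  · simpa using h.1
  · simpa using h.2.1
  · simpa using h.2.2

/-- The coordinates of `PG(5,q³)` in which the points of `PG(5,q)` are the vectors of conjugates. -/
noncomputable def conjCoord (e : (K × K) ≃ₗ[F] (Fin 6 → F)) :
    (Fin 6 → K) →ₗ[K] (Fin 3 → K) × (Fin 3 → K) :=
  Fintype.linearCombination K (fun i : Fin 6 =>
    ((conjugates F K).prodMap (conjugates F K)) (e.symm (fun j => if i = j then 1 else 0)))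

variable {e : (K × K) ≃ₗ[F] (Fin 6 → F)}

theorem conjCoord_extVec (v : Fin 6 → F) : conjCoord e (extVec K v) =
    (conjugates F K (e.symm v).1, conjugates F K (e.symm v).2) := by
  have h := LinearMap.pi_apply_eq_sum_univ
    (((conjugates F K).prodMap (conjugates F K)) ∘ₗ (e.symm : (Fin 6 → F) →ₗ[F] (K × K))) v
  rw [conjCoord, Fintype.linearCombination_apply]
  simp only [extVec, algebraMap_smul]
  exact h.symm

/-- Frobenius permutes the conjugates cyclically, so conjugation in `PG(5,q³)` shifts the index in
`Fin 3`, where addition is modulo 3. -/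
theorem conjCoord_frob (hK : Module.finrank F K = 3) (w : Fin 6 → K) (i : Fin 3) :
    (conjCoord e (fun k => w k ^ Nat.card F)).1 (i + 1) = frob F ((conjCoord e w).1 i) ∧
    (conjCoord e (fun k => w k ^ Nat.card F)).2 (i + 1) = frob F ((conjCoord e w).2 i) := by
  simp only [conjCoord, Fintype.linearCombination_apply, Prod.fst_sum, Prod.snd_sum,
    Finset.sum_apply, Prod.smul_fst, Prod.smul_snd, Pi.smul_apply, smul_eq_mul, map_sum, map_mul,
    LinearMap.prodMap_apply, conjugates_succ hK, frob_apply, and_self]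

theorem conjCoord_bijective (hK : Module.finrank F K = 3) :
    Function.Bijective (conjCoord e) := by
  have hsurj : Function.Surjective (conjCoord e) := by
    rw [← LinearMap.range_eq_top]
    have hmem (x y : K) : (conjugates F K x, conjugates F K y) ∈ LinearMap.range (conjCoord e) :=
      ⟨extVec K (e (x, y)), by rw [conjCoord_extVec, LinearEquiv.symm_apply_apply]⟩
    have h1 : ⊤ ≤ (LinearMap.range (conjCoord e)).comap
        (LinearMap.inl K (Fin 3 → K) (Fin 3 → K)) := by
      rw [← span_range_conjugates hK, Submodule.span_le]
      rintro _ ⟨x, rfl⟩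
      have := hmem x 0
      rwa [map_zero] at this
    have h2 : ⊤ ≤ (LinearMap.range (conjCoord e)).comap
        (LinearMap.inr K (Fin 3 → K) (Fin 3 → K)) := by
      rw [← span_range_conjugates hK, Submodule.span_le]
      rintro _ ⟨x, rfl⟩
      have := hmem 0 x
      rwa [map_zero] at this
    rw [eq_top_iff]
    rintro ⟨X, Y⟩ -
    have := add_mem (Submodule.mem_comap.mp (h1 (Submodule.mem_top (R := K) (x := X))))
      (Submodule.mem_comap.mp (h2 (Submodule.mem_top (R := K) (x := Y))))
    simpa using this
  exact ⟨(LinearMap.injective_iff_surjective_of_finrank_eq_finrank (by simp)).mpr hsurj, hsurj⟩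

/-- The equation `y = m x` and its conjugates hold on the base plane. They suffice because the
vectors of conjugates span `K³`. -/
theorem mem_extSubspace_kLine (hK : Module.finrank F K = 3) {m : K} {w : Fin 6 → K} :
    w ∈ extSubspace K (kLine e (1, m)) ↔
      ∀ i, (conjCoord e w).2 i = conjugates F K m i * (conjCoord e w).1 i := by
  constructor
  · intro h
    refine Submodule.span_induction ?_ ?_ ?_ ?_ h
    · rintro _ ⟨v, hv, rfl⟩ i
      obtain ⟨x, rfl⟩ := mem_kLine.mp hv
      rw [conjCoord_extVec, LinearEquiv.symm_apply_apply]
      simp [conjugates_mul, mul_comm]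
    · simp
    · intro v v' _ _ h1 h2 i
      simp only [map_add, Prod.snd_add, Prod.fst_add, Pi.add_apply, h1 i, h2 i]
      ring
    · intro r v _ h1 i
      simp only [map_smul, Prod.smul_snd, Prod.smul_fst, Pi.smul_apply, smul_eq_mul, h1 i]
      ring
  · intro h
    let Φ := LinearEquiv.ofBijective (conjCoord e) (conjCoord_bijective hK)
    let ι : (Fin 3 → K) →ₗ[K] (Fin 6 → K) := (Φ.symm : _ →ₗ[K] (Fin 6 → K)) ∘ₗ
      LinearMap.prod LinearMap.id (LinearMap.pi fun i => conjugates F K m i • LinearMap.proj i)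
    have h1 : ⊤ ≤ (extSubspace K (kLine e (1, m))).comap ι := by
      rw [← span_range_conjugates hK, Submodule.span_le]
      rintro _ ⟨x, rfl⟩
      have : ι (conjugates F K x) = extVec K (e (x • (1, m))) := by
        simp only [ι, LinearMap.comp_apply, LinearEquiv.coe_coe]
        rw [LinearEquiv.symm_apply_eq]
        simp only [Φ, LinearEquiv.ofBijective_apply, conjCoord_extVec,
          LinearEquiv.symm_apply_apply]
        refine Prod.ext (by simp) ?_
        ext i
        simp [conjugates_mul, mul_comm]
      rw [SetLike.mem_coe, Submodule.mem_comap, this]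
      exact Submodule.subset_span ⟨_, smul_mem_kLine _ _, rfl⟩
    have h2 := h1 (Submodule.mem_top (x := (conjCoord e w).1))
    have h3 : ι (conjCoord e w).1 = w := by
      simp only [ι, LinearMap.comp_apply, LinearEquiv.coe_coe]
      rw [LinearEquiv.symm_apply_eq]
      simp only [Φ, LinearEquiv.ofBijective_apply]
      refine Prod.ext (by simp) ?_
      ext i
      simp [h i]
    rwa [Submodule.mem_comap, h3] at h2

/-- The three coordinate lines. -/
noncomputable def coordLine (e : (K × K) ≃ₗ[F] (Fin 6 → F)) (i : Fin 3) :
    Submodule K (Fin 6 → K) :=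
  (LinearMap.range ((LinearMap.single K (fun _ : Fin 3 => K) i).prodMap
    (LinearMap.single K (fun _ : Fin 3 => K) i))).comap (conjCoord e)

theorem mem_coordLine {i : Fin 3} {w : Fin 6 → K} :
    w ∈ coordLine e i ↔ ∀ j, j ≠ i → (conjCoord e w).1 j = 0 ∧ (conjCoord e w).2 j = 0 := by
  rw [coordLine, Submodule.mem_comap]
  constructor
  · rintro ⟨⟨x, y⟩, h⟩ j hj
    rw [← h]
    simp [hj]
  · intro h
    refine ⟨((conjCoord e w).1 i, (conjCoord e w).2 i), Prod.ext ?_ ?_⟩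
    all_goals
      ext j
      by_cases hj : j = i
      · subst hj; simp
      · simp [hj, h j hj]

theorem isProjLine_coordLine (hK : Module.finrank F K = 3) (i : Fin 3) :
    IsProjLine (coordLine e i) := by
  let Φ := LinearEquiv.ofBijective (conjCoord e) (conjCoord_bijective hK)
  have h : coordLine e i = (LinearMap.range ((LinearMap.single K (fun _ : Fin 3 => K) i).prodMap
    (LinearMap.single K (fun _ : Fin 3 => K) i))).map (Φ.symm : _ →ₗ[K] (Fin 6 → K)) :=
    (Submodule.map_equiv_eq_comap_symm Φ.symm _).symm
  rw [IsProjLine, h]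
  refine (LinearEquiv.finrank_map_eq Φ.symm _).trans ?_
  rw [LinearMap.finrank_range_of_inj]
  · simp
  · exact Function.Injective.prodMap (Pi.single_injective (M := fun _ => K) i)
      (Pi.single_injective (M := fun _ => K) i)

theorem isTransversalLine_coordLine (hK : Module.finrank F K = 3) (i : Fin 3) :
    IsTransversalLine (normPlanes e) (coordLine e i) := by
  refine ⟨isProjLine_coordLine hK i, ?_⟩
  rintro _ ⟨m, -, rfl⟩
  obtain ⟨w, hw⟩ := (conjCoord_bijective (e := e) hK).2
    (Pi.single i 1, Pi.single i (conjugates F K m i))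
  rw [meets_iff]
  refine ⟨w, ?_, mem_coordLine.mpr fun j hj => ?_, (mem_extSubspace_kLine hK).mpr fun j => ?_⟩
  · rintro rfl
    have := congrFun (congrArg Prod.fst hw) i
    simp at this
  · simp [hw, hj]
  · rw [hw]
    by_cases hj : j = i
    · subst hj; simp
    · simp [hj]

/-- A single vanishing conjugate forces the element to vanish, and a coordinate line makes some
conjugate of both components vanish. -/
theorem disjointFromBase_coordLine (i : Fin 3) : DisjointFromBase F (coordLine e i) := by
  intro v hv h
  obtain ⟨j, hj⟩ : ∃ j : Fin 3, j ≠ i := exists_ne i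
  have h1 := mem_coordLine.mp h j hj
  rw [conjCoord_extVec] at h1
  have hx : (e.symm v).1 = 0 := conjugates_injective (F := F) j (by simpa using h1.1)
  have hy : (e.symm v).2 = 0 := conjugates_injective (F := F) j (by simpa using h1.2)
  have : e.symm v = 0 := Prod.ext hx hy
  exact hv (by simpa using this)

theorem conjSubspace_coordLine (hK : Module.finrank F K = 3) (i : Fin 3) :
    conjSubspace F (coordLine e i) = coordLine e (i + 1) := by
  apply le_antisymm
  · rw [conjSubspace, Submodule.span_le]
    rintro _ ⟨w, hw, rfl⟩
    refine mem_coordLine.mpr fun j hj => ?_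
    obtain ⟨k, rfl⟩ : ∃ k, j = k + 1 := ⟨j - 1, by simp⟩
    have hk := mem_coordLine.mp hw k (fun h => hj (by rw [h]))
    have := conjCoord_frob (e := e) hK w k
    simpa [hk] using this
  · intro w hw
    -- Frobenius has order 3 on `K`, so its square provides the preimage under the coordinatewise
    -- `q`-th power.
    refine Submodule.subset_span ⟨fun k => frob F (frob F (w k)), ?_, ?_⟩
    · refine mem_coordLine.mpr fun j hj => ?_
      have h1 := conjCoord_frob (e := e) hK (fun k => frob F (frob F (w k))) j
      simp only [← frob_apply, frob_frob_frob hK] at h1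
      have h2 := mem_coordLine.mp hw (j + 1) (fun h => hj (by simpa using h))
      rw [h2.1, h2.2] at h1
      exact ⟨frob_injective (h1.1.symm.trans (map_zero _).symm),
        frob_injective (h1.2.symm.trans (map_zero _).symm)⟩
    · ext k
      simp only [← frob_apply, frob_frob_frob hK]

theorem coordLine_injective (hK : Module.finrank F K = 3) :
    Function.Injective (coordLine e) := by
  intro i j h
  by_contra hij
  obtain ⟨w, hw⟩ := (conjCoord_bijective (e := e) hK).2 (Pi.single i 1, 0)
  have h1 : w ∈ coordLine e i := mem_coordLine.mpr fun k hk => by simp [hw, hk]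
  rw [h] at h1
  have := (mem_coordLine.mp h1 i hij).1
  simp [hw] at this

/-- The coefficients of an expression that vanishes on the elements of norm 1. -/
theorem eq_zero_of_forall_cubicNorm (hK : Module.finrank F K = 3) {r s t u : K}
    (h : ∀ m : K, cubicNorm F m = 1 → r * (m * frob F m) + s * m + t * frob F m + u = 0) :
    r = 0 ∧ s = 0 := by
  have hq := one_lt_card F
  let p : Polynomial K := Polynomial.C r * Polynomial.X ^ (Nat.card F + 1) +
    Polynomial.C s * Polynomial.X ^ 1 + Polynomial.C t * Polynomial.X ^ Nat.card F +
    Polynomial.C u * Polynomial.X ^ 0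
  have hp : p = 0 := by
    refine eq_zero_of_eval_cubicNorm hK ?_ fun m hm => ?_
    · have h (c : K) (n : ℕ) (hn : n ≤ Nat.card F + 1) :
          (Polynomial.C c * Polynomial.X ^ n).natDegree ≤ Nat.card F + 1 :=
        (Polynomial.natDegree_C_mul_X_pow_le c n).trans hn
      exact Polynomial.natDegree_add_le_of_degree_le (Polynomial.natDegree_add_le_of_degree_le
        (Polynomial.natDegree_add_le_of_degree_le (h _ _ (by omega)) (h _ _ (by omega)))
        (h _ _ (by omega))) (h _ _ (by omega))
    · rw [← h m hm, frob_apply]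
      simp [p, pow_succ']
  have h1 : p.coeff (Nat.card F + 1) = 0 := by rw [hp]; simp
  have h2 : p.coeff 1 = 0 := by rw [hp]; simp
  simp only [p, Polynomial.coeff_add, Polynomial.coeff_C_mul, Polynomial.coeff_X_pow] at h1 h2
  rw [if_pos trivial, if_neg (by omega), if_neg (by omega), if_neg (by omega)] at h1
  rw [if_neg (by omega), if_pos trivial, if_neg (by omega), if_neg (by omega)] at h2
  exact ⟨by simpa using h1, by simpa using h2⟩

variable (F K) in
theorem exists_cubicNorm_ne_one (hK : Module.finrank F K = 3) :
    ∃ m : K, cubicNorm F m = 1 ∧ m ≠ 1 := by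
  have := finite_cubic hK
  have hq := one_lt_card F
  have h : 1 < {m : K | cubicNorm F m = 1}.ncard := by
    rw [ncard_cubicNorm_eq_one F K hK]
    omega
  obtain ⟨m, hm, hne⟩ := Set.exists_ne_of_one_lt_ncard h 1
  exact ⟨m, hm, hne⟩

/-- The line is spanned by its points `v` and `w` in the planes of `1` and of some `m ≠ 1`. Meeting
all other planes forces `v` and `w` to be supported on one common coordinate. -/
theorem eq_coordLine_of_isTransversalLine (hK : Module.finrank F K = 3)
    {l : Submodule K (Fin 6 → K)} (hl : IsTransversalLine (normPlanes e) l) :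
    ∃ i, l = coordLine e i := by
  obtain ⟨hl2, hmeet⟩ := hl
  have hinj := (conjCoord_bijective (e := e) hK).1
  have hpt (m : K) (hm : cubicNorm F m = 1) : ∃ w, w ∈ l ∧ (∃ i, (conjCoord e w).1 i ≠ 0) ∧
      ∀ i, (conjCoord e w).2 i = conjugates F K m i * (conjCoord e w).1 i := by
    obtain ⟨w, hw0, hwl, hwm⟩ := meets_iff.mp (hmeet _ ⟨m, hm, rfl⟩)
    rw [mem_extSubspace_kLine hK] at hwm
    refine ⟨w, hwl, ?_, hwm⟩
    by_contra! h
    refine hw0 (hinj ?_)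
    rw [map_zero]
    refine Prod.ext (funext h) (funext fun i => ?_)
    rw [hwm, h i, mul_zero]
    rfl
  obtain ⟨m, hm, hm1⟩ := exists_cubicNorm_ne_one F K hK
  obtain ⟨v, hvl, ⟨i, hi⟩, hv⟩ := hpt 1 cubicNorm_one
  obtain ⟨w, hwl, ⟨j, hj⟩, hw⟩ := hpt m hm
  have hne (k : Fin 3) : conjugates F K 1 k - conjugates F K m k ≠ 0 := fun h =>
    hm1 (conjugates_injective k (sub_eq_zero.mp h)).symm
  have hind : LinearIndependent K ![v, w] := by
    rw [LinearIndependent.pair_iff]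
    intro s t hst
    have h1 (k : Fin 3) : s * (conjCoord e v).1 k + t * (conjCoord e w).1 k = 0 := by
      have := congrFun (congrArg Prod.fst (congrArg (conjCoord e) hst)) k
      simpa using this
    have h2 (k : Fin 3) : s * (conjugates F K 1 k * (conjCoord e v).1 k) +
        t * (conjugates F K m k * (conjCoord e w).1 k) = 0 := by
      have := congrFun (congrArg Prod.snd (congrArg (conjCoord e) hst)) k
      simpa [hv, hw] using this
    constructor
    · have : s * (conjCoord e v).1 i * (conjugates F K 1 i - conjugates F K m i) = 0 := by
        linear_combination h2 i - conjugates F K m i * h1 i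
      simpa [hi, hne i] using this
    · have : t * (conjCoord e w).1 j * (conjugates F K 1 j - conjugates F K m j) = 0 := by
        linear_combination conjugates F K 1 j * h1 j - h2 j
      simpa [hj, hne j] using this
  have hspan := eq_span_pair_of_finrank hl2 hvl hwl hind
  -- The point `s v + t w` in the plane of `n` gives one homogeneous equation in `(s, t)` for each
  -- coordinate. A nonzero solution makes every `2 × 2` determinant vanish.
  have hdet (n : K) (hn : cubicNorm F n = 1) (a b : Fin 3) :
      (conjCoord e v).1 a * (conjCoord e w).1 b * (conjugates F K n a - conjugates F K 1 a) *
        (conjugates F K n b - conjugates F K m b) =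
      (conjCoord e v).1 b * (conjCoord e w).1 a * (conjugates F K n b - conjugates F K 1 b) *
        (conjugates F K n a - conjugates F K m a) := by
    obtain ⟨u, hul, ⟨k, hk⟩, hu⟩ := hpt n hn
    rw [hspan, Submodule.mem_span_pair] at hul
    obtain ⟨s, t, rfl⟩ := hul
    simp only [map_add, map_smul, Prod.fst_add, Prod.snd_add, Prod.smul_fst, Prod.smul_snd,
      Pi.add_apply, Pi.smul_apply, smul_eq_mul, hv, hw] at hu hk
    have hs : s ≠ 0 ∨ t ≠ 0 := by
      by_contra! h
      simp [h.1, h.2] at hk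
    have ha := hu a
    have hb := hu b
    rw [← sub_eq_zero]
    rcases hs with hs | hs
    · apply (mul_eq_zero.mp _).resolve_left hs
      linear_combination (conjCoord e w).1 a * (conjugates F K n a - conjugates F K m a) * hb -
        (conjCoord e w).1 b * (conjugates F K n b - conjugates F K m b) * ha
    · apply (mul_eq_zero.mp _).resolve_left hs
      linear_combination (conjCoord e v).1 b * (conjugates F K n b - conjugates F K 1 b) * ha -
        (conjCoord e v).1 a * (conjugates F K n a - conjugates F K 1 a) * hb
  -- For consecutive indices the conjugates of `n` are `z` and `z^q`. The determinant is then a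
  -- polynomial in `z` with monomials `z^(q+1)`, `z`, `z^q`, `1`, vanishing on the norm 1 group.
  have hcyc (a : Fin 3) : (conjCoord e v).1 a * (conjCoord e w).1 (a + 1) = 0 ∧
      (conjCoord e v).1 (a + 1) * (conjCoord e w).1 a = 0 := by
    obtain ⟨h1, h2⟩ := eq_zero_of_forall_cubicNorm (F := F) hK
      (r := (conjCoord e v).1 a * (conjCoord e w).1 (a + 1) -
        (conjCoord e v).1 (a + 1) * (conjCoord e w).1 a)
      (s := (conjCoord e v).1 (a + 1) * (conjCoord e w).1 a * conjugates F K 1 (a + 1) -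
        (conjCoord e v).1 a * (conjCoord e w).1 (a + 1) * conjugates F K m (a + 1))
      (t := (conjCoord e v).1 (a + 1) * (conjCoord e w).1 a * conjugates F K m a -
        (conjCoord e v).1 a * (conjCoord e w).1 (a + 1) * conjugates F K 1 a)
      (u := (conjCoord e v).1 a * (conjCoord e w).1 (a + 1) * conjugates F K 1 a *
          conjugates F K m (a + 1) -
        (conjCoord e v).1 (a + 1) * (conjCoord e w).1 a * conjugates F K 1 (a + 1) *
          conjugates F K m a)
      (fun n hn => by
        obtain ⟨n', hn', rfl⟩ := exists_conjugates_eq (F := F) hK a hn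
        have := hdet n' hn' a (a + 1)
        rw [conjugates_succ hK n'] at this
        linear_combination this)
    have h3 : (conjCoord e v).1 a * (conjCoord e w).1 (a + 1) *
        (conjugates F K 1 (a + 1) - conjugates F K m (a + 1)) = 0 := by
      linear_combination h2 + conjugates F K 1 (a + 1) * h1
    have h4 := (mul_eq_zero.mp h3).resolve_right (hne _)
    exact ⟨h4, by linear_combination h4 - h1⟩
  have hoff (a b : Fin 3) (hab : a ≠ b) : (conjCoord e v).1 a * (conjCoord e w).1 b = 0 := by
    -- Modulo 3, any two distinct indices are cyclic neighbours.
    have : b = a + 1 ∨ a = b + 1 := by revert a b; decide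
    rcases this with rfl | rfl
    · exact (hcyc a).1
    · exact (hcyc b).2
  have hw0 (k : Fin 3) (hk : k ≠ i) : (conjCoord e w).1 k = 0 :=
    (mul_eq_zero.mp (hoff i k hk.symm)).resolve_left hi
  have hji : j = i := by
    by_contra h
    exact hj (hw0 j h)
  subst hji
  have hv0 (k : Fin 3) (hk : k ≠ j) : (conjCoord e v).1 k = 0 :=
    (mul_eq_zero.mp (hoff k j hk)).resolve_right hj
  refine ⟨j, ?_⟩
  rw [hspan]
  refine (eq_span_pair_of_finrank (isProjLine_coordLine hK j) ?_ ?_ hind).symm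
  · exact mem_coordLine.mpr fun k hk => ⟨hv0 k hk, by rw [hv, hv0 k hk, mul_zero]⟩
  · exact mem_coordLine.mpr fun k hk => ⟨hw0 k hk, by rw [hw, hw0 k hk, mul_zero]⟩

theorem hasExactlyThreeConjTransversals_normPlanes (hK : Module.finrank F K = 3)
    (e : (K × K) ≃ₗ[F] (Fin 6 → F)) : HasExactlyThreeConjTransversals K (normPlanes e) := by
  have h1 : conjSubspace F (coordLine e 0) = coordLine e 1 := conjSubspace_coordLine hK 0
  have h2 : conjSubspace F (coordLine e 1) = coordLine e 2 := conjSubspace_coordLine hK 1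
  have hinj := coordLine_injective (e := e) hK
  refine ⟨coordLine e 0, ?_⟩
  rw [h1, h2]
  refine ⟨?_, hinj.ne (by decide), hinj.ne (by decide), hinj.ne (by decide),
    disjointFromBase_coordLine 0, disjointFromBase_coordLine 1, disjointFromBase_coordLine 2⟩
  ext l
  simp only [Set.mem_ofPred_eq, Set.mem_insert_iff, Set.mem_singleton_iff]
  constructor
  · intro hl
    obtain ⟨i, rfl⟩ := eq_coordLine_of_isTransversalLine hK hl
    fin_cases i <;> simp
  · rintro (rfl | rfl | rfl) <;> exact isTransversalLine_coordLine hK _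

end ConjugateCoordinates

-- Classification of the covers of the norm family.

section Covers

variable {F K : Type*} [Field F] [Finite F] [Field K] [Algebra F K]

variable (F K) in
/-- The Frobenius automorphism of a cubic extension as a linear equivalence. -/
noncomputable def frobEquiv (hK : Module.finrank F K = 3) : K ≃ₗ[F] K :=
  { (frob F : K →ₐ[F] K).toLinearMap with
    invFun := fun x => frob F (frob F x)
    left_inv := fun x => frob_frob_frob hK x
    right_inv := fun x => frob_frob_frob hK x }

/-- Applying Frobenius to the second coordinate. -/
noncomputable def twist (hK : Module.finrank F K = 3) (e : (K × K) ≃ₗ[F] (Fin 6 → F)) :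
    (K × K) ≃ₗ[F] (Fin 6 → F) :=
  ((LinearEquiv.refl F K).prodCongr (frobEquiv F K hK)).trans e

variable (hK : Module.finrank F K = 3) {e e' : (K × K) ≃ₗ[F] (Fin 6 → F)}

theorem twist_apply (x y : K) : twist hK e (x, y) = e (x, frob F y) := rfl

theorem twist_twist_twist : twist hK (twist hK (twist hK e)) = e := by
  ext1 ⟨x, y⟩
  simp only [twist_apply, frob_frob_frob hK]

theorem exists_twist_apply (v : Fin 6 → F) : ∃ x y, v = twist hK e (x, y) :=
  ⟨_, _, ((twist hK e).apply_symm_apply v).symm⟩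

theorem not_meets_normPlanes {U W : Submodule F (Fin 6 → F)} (hU : U ∈ normPlanes e)
    (hW : W ∈ normPlanes e) (h : U ≠ W) : ¬ Meets U W := by
  obtain ⟨m, -, rfl⟩ := hU
  obtain ⟨n, -, rfl⟩ := hW
  exact not_meets_kLine h

include hK in
theorem isCover_normPlanes_symm (h : IsCover (normPlanes e) (normPlanes e')) :
    IsCover (normPlanes e') (normPlanes e) := by
  refine ⟨ncard_normPlanes hK e, ?_, fun U hU W hW => not_meets_normPlanes hU hW,
    fun v hv => (h.2.2.2.1 v hv).symm, fun U hU W hW => ?_⟩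
  · rintro _ ⟨m, -, rfl⟩
    exact isProjPlane_kLine hK (mk_one_ne_zero m)
  · rw [inf_comm]
    exact h.2.2.2.2 W hW U hU

/-- The norm is invariant under Frobenius, so the covered points agree. The planes `y = m x` and `y
= (n x)^q` meet where `x^q = (m / n^q) x`, an equation whose solutions form one `F`-line by Hilbert
90. -/
theorem isCover_twist (e : (K × K) ≃ₗ[F] (Fin 6 → F)) :
    IsCover (normPlanes e) (normPlanes (twist hK e)) := by
  refine ⟨ncard_normPlanes hK _, ?_, fun U hU W hW => not_meets_normPlanes hU hW,
    fun v hv => ?_, ?_⟩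
  · rintro _ ⟨m, -, rfl⟩
    exact isProjPlane_kLine hK (mk_one_ne_zero m)
  · obtain ⟨x, y, rfl⟩ := exists_twist_apply (e := e) hK v
    have h0 : (x, y) ≠ 0 := by
      intro h0
      exact hv (by rw [h0, map_zero])
    rw [exists_normPlanes_iff h0]
    rw [twist_apply, ne_eq, LinearEquiv.map_eq_zero_iff] at hv
    rw [twist_apply, exists_normPlanes_iff hv, cubicNorm_frob hK]
  · rintro _ ⟨m, hm, rfl⟩ _ ⟨n, hn, rfl⟩
    have hm' : cubicNorm F m = 1 := hm
    have hn' : cubicNorm F n = 1 := hn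
    have hn0 := frob_ne_zero (F := F) (ne_zero_of_cubicNorm hn')
    obtain ⟨x, hx, hxm⟩ := exists_frob_eq_mul hK (m := m / frob F n)
      (by rw [cubicNorm_div, cubicNorm_frob hK, hm', hn', div_one])
    have hx' : frob F x * frob F n = x * m := by
      rw [hxm]
      field_simp
    suffices h : kLine e (1, m) ⊓ kLine (twist hK e) (1, n) = Submodule.span F {e (x, x * m)} by
      rw [h, finrank_span_singleton]
      rw [ne_eq, LinearEquiv.map_eq_zero_iff]
      exact fun h => hx (congrArg Prod.fst h)
    apply le_antisymm
    · rintro v ⟨hv1, hv2⟩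
      obtain ⟨y, z, rfl⟩ := exists_twist_apply (e := e) hK v
      have h2 := apply_mem_kLine_one.mp hv2
      rw [SetLike.mem_coe, twist_apply, apply_mem_kLine_one] at hv1
      rw [h2, map_mul] at hv1
      have hm0 := ne_zero_of_cubicNorm hm'
      -- Two nonzero solutions of `x^q = μ x` have a quotient fixed by Frobenius.
      obtain ⟨f, hf⟩ := exists_algebraMap_of_frob_eq (F := F) (x := y / x) (by
        rw [map_div₀, div_eq_div_iff (frob_ne_zero hx) hx]
        apply mul_right_cancel₀ hm0
        apply mul_right_cancel₀ hn0
        linear_combination (x * m) * hv1 - m * y * hx')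
      rw [Submodule.mem_span_singleton]
      refine ⟨f, ?_⟩
      rw [← map_smul, twist_apply, h2, map_mul, hv1]
      have : algebraMap F K f * x = y := by rw [hf]; field_simp
      congr 1
      refine Prod.ext ?_ ?_
      · simp [Algebra.smul_def, this]
      · simp [Algebra.smul_def, ← mul_assoc, this]
    · rw [Submodule.span_singleton_le_iff_mem]
      refine ⟨apply_mem_kLine_one.mpr rfl, ?_⟩
      have : e (x, x * m) = twist hK e (x, x * n) := by
        rw [twist_apply, map_mul, hx']
      rw [SetLike.mem_coe, this]
      exact apply_mem_kLine_one.mpr rfl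

/-- Three twists are the identity, so `e` is itself a twist of the double twist, and the cover
relation between norm families is symmetric. -/
theorem isCover_twist_twist (e : (K × K) ≃ₗ[F] (Fin 6 → F)) :
    IsCover (normPlanes e) (normPlanes (twist hK (twist hK e))) := by
  apply isCover_normPlanes_symm hK
  have := isCover_twist hK (twist hK (twist hK e))
  rwa [twist_twist_twist] at this

/-- The second family is the twist of the first, hence covers it. This prevents a cover from mixing
the two. -/
theorem meets_twist {m n : K} (hm : cubicNorm F m = 1) (hn : cubicNorm F n = 1) :
    Meets (kLine (twist hK e) (1, m)) (kLine (twist hK (twist hK e)) (1, n)) := by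
  have := (isCover_twist hK (twist hK e)).2.2.2.2 _ ⟨m, hm, rfl⟩ _ ⟨n, hn, rfl⟩
  intro h
  rw [h] at this
  simp at this

-- A plane disjoint from `x = 0` projects injectively to the first coordinate, and dimension 3 makes
-- the projection bijective.
omit [Finite F] in
theorem exists_graph_of_isProjPlane {U : Submodule F (Fin 6 → F)} (hU : IsProjPlane U)
    (h0 : ∀ y, e (0, y) ∈ U → y = 0) (hK : Module.finrank F K = 3) :
    ∃ f : K →ₗ[F] K, ∀ x, e (x, f x) ∈ U := by
  have : Module.Finite F K := Module.finite_of_finrank_pos (by omega)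
  let g : U →ₗ[F] K := (LinearMap.fst F K K) ∘ₗ (e.symm : (Fin 6 → F) →ₗ[F] K × K) ∘ₗ U.subtype
  have hinj : Function.Injective g := by
    rw [← LinearMap.ker_eq_bot, LinearMap.ker_eq_bot']
    rintro ⟨v, hv⟩ h
    have hfst : (e.symm v).1 = 0 := h
    have hsnd : (e.symm v).2 = 0 := h0 _ (by
      rw [← hfst, Prod.mk.eta, LinearEquiv.apply_symm_apply]
      exact hv)
    have : e.symm v = 0 := Prod.ext hfst hsnd
    simpa using this
  have hU' : Module.finrank F U = Module.finrank F K := by rw [hK]; exact hU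
  let G := LinearEquiv.ofInjectiveOfFinrankEq g hinj hU'
  refine ⟨(LinearMap.snd F K K) ∘ₗ (e.symm : (Fin 6 → F) →ₗ[F] K × K) ∘ₗ U.subtype ∘ₗ
    (G.symm : K →ₗ[F] U), fun x => ?_⟩
  have h1 : (e.symm (G.symm x : Fin 6 → F)).1 = x := G.apply_symm_apply x
  have h2 : e (x, (e.symm (G.symm x : Fin 6 → F)).2) = (G.symm x : Fin 6 → F) :=
    (LinearEquiv.eq_symm_apply e).mp (Prod.ext h1.symm rfl)
  change e (x, (e.symm (G.symm x : Fin 6 → F)).2) ∈ U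
  rw [h2]
  exact (G.symm x).2

variable (F K) in
/-- The elements of norm 1 as a finite set. -/
noncomputable def normOneFinset (hK : Module.finrank F K = 3) : Finset K :=
  have := finite_cubic hK
  (Set.toFinite {m : K | cubicNorm F m = 1}).toFinset

theorem mem_normOneFinset {m : K} : m ∈ normOneFinset F K hK ↔ cubicNorm F m = 1 := by
  simp [normOneFinset]

/-- The order `q² + q + 1` is 1 in `K` because `q = 0` there, so a constant equals its own sum over
the norm 1 group. -/
theorem card_normOneFinset_cast : ((normOneFinset F K hK).card : K) = 1 := by
  have := finite_cubic hK
  have h : (normOneFinset F K hK).card = Nat.card F ^ 2 + Nat.card F + 1 := by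
    rw [normOneFinset, ← Set.ncard_eq_toFinset_card, ncard_cubicNorm_eq_one F K hK]
  have hF : (Nat.card F : K) = 0 := by
    let _ := Fintype.ofFinite F
    rw [Nat.card_eq_fintype_card, ← map_natCast (algebraMap F K), FiniteField.cast_card_eq_zero,
      map_zero]
  rw [h]
  simp [hF]

/-- Multiplying the variable by `m` permutes the group and multiplies the sum by `f m ≠ 1`. -/
theorem sum_normOneFinset {f : K → K} (hf : ∀ x y, f (x * y) = f x * f y)
    (h1 : ∃ m, cubicNorm F m = 1 ∧ f m ≠ 1) : ∑ m ∈ normOneFinset F K hK, f m = 0 := by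
  obtain ⟨m, hm, hm1⟩ := h1
  have hm0 := ne_zero_of_cubicNorm hm
  have h : ∑ x ∈ normOneFinset F K hK, f x = ∑ x ∈ normOneFinset F K hK, f (m * x) := by
    symm
    refine Finset.sum_nbij' (fun x => m * x) (fun x => x / m) ?_ ?_ ?_ ?_ ?_
    · intro x hx
      rw [mem_normOneFinset] at hx ⊢
      rw [cubicNorm_mul, hm, hx, mul_one]
    · intro x hx
      rw [mem_normOneFinset] at hx ⊢
      rw [cubicNorm_div, hm, hx, div_one]
    · intro x _
      field_simp
    · intro x _
      field_simp
    · intro x _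
      rfl
  simp only [hf, ← Finset.mul_sum] at h
  have h2 : (f m - 1) * ∑ x ∈ normOneFinset F K hK, f x = 0 := by
    linear_combination -h
  exact (mul_eq_zero.mp h2).resolve_left (sub_ne_zero.mpr hm1)

theorem sum_normOneFinset_id : ∑ m ∈ normOneFinset F K hK, m = 0 :=
  sum_normOneFinset hK (fun _ _ => rfl) (exists_cubicNorm_ne_one F K hK)

theorem sum_normOneFinset_mul_frob : ∑ m ∈ normOneFinset F K hK, m * frob F m = 0 := by
  refine sum_normOneFinset hK (fun x y => by rw [map_mul]; ring) ?_
  obtain ⟨m, hm, hm1⟩ := exists_cubicNorm_ne_one F K hK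
  refine ⟨m, hm, fun h => hm1 ?_⟩
  rw [cubicNorm, h, one_mul] at hm
  apply frob_injective (F := F)
  apply frob_injective (F := F)
  rw [hm, map_one, map_one]

theorem sum_of_permutes_normOneFinset [DecidableEq K] {f : K → K}
    (hf : (normOneFinset F K hK).image f = normOneFinset F K hK) :
    ∑ m ∈ normOneFinset F K hK, f m = 0 := by
  have hinj : Set.InjOn f (normOneFinset F K hK) := by
    rw [← Finset.card_image_iff, hf]
  have := Finset.sum_image (f := fun x => x) hinj
  rw [hf, sum_normOneFinset_id] at this
  exact this.symm

include hK in
/-- The linear maps that preserve the norm and whose quotients by the identity take all the values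
of norm 1 are multiples of the two nontrivial automorphisms. -/
theorem frob_expansion_of_permutes {a b c : K}
    (hsurj : ∀ m, cubicNorm F m = 1 →
      ∃ x : K, x ≠ 0 ∧ a * x + b * frob F x + c * frob F (frob F x) = x * m)
    (hnorm : ∀ x : K, x ≠ 0 →
      cubicNorm F (a * x + b * frob F x + c * frob F (frob F x)) = cubicNorm F x) :
    a = 0 ∧ (b = 0 ∨ c = 0) := by
  classical
  -- By Hilbert 90 every `z` of norm 1 is `x^q / x`; the bracket is the quotient of the linear map
  -- by `x`, written in terms of `z`.
  have hmaps (z : K) (hz : cubicNorm F z = 1) : cubicNorm F (a + b * z + c * (z * frob F z)) = 1 := by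
    obtain ⟨x, hx, hxz⟩ := exists_frob_eq_mul hK hz
    have := hnorm x hx
    have h2 : a * x + b * frob F x + c * frob F (frob F x) =
        x * (a + b * z + c * (z * frob F z)) := by
      rw [hxz, map_mul, hxz]; ring
    rw [h2, cubicNorm_mul] at this
    exact (mul_eq_left₀ (cubicNorm_ne_zero hx)).mp this
  have himage : (normOneFinset F K hK).image (fun z => a + b * z + c * (z * frob F z)) =
      normOneFinset F K hK := by
    ext m
    simp only [Finset.mem_image, mem_normOneFinset]
    constructor
    · rintro ⟨z, hz, rfl⟩
      exact hmaps z hz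
    · intro hm
      obtain ⟨x, hx, hxm⟩ := hsurj m hm
      refine ⟨frob F x / x, ?_, ?_⟩
      · rw [cubicNorm_div, cubicNorm_frob hK, div_self (cubicNorm_ne_zero hx)]
      · have hx1 := frob_ne_zero (F := F) hx
        rw [map_div₀]
        field_simp
        linear_combination hxm
  -- Over the norm 1 group the terms in `z` and `z^(q+1)` sum to zero and the constant `a` sums to
  -- `a`, while the sum of a permutation of the group is zero.
  have ha : a = 0 := by
    have := sum_of_permutes_normOneFinset hK himage
    rwa [Finset.sum_add_distrib, Finset.sum_add_distrib, ← Finset.mul_sum, ← Finset.mul_sum,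
      sum_normOneFinset_id, sum_normOneFinset_mul_frob, Finset.sum_const, nsmul_eq_mul,
      card_normOneFinset_cast, mul_zero, add_zero, mul_zero, add_zero, one_mul] at this
  refine ⟨ha, or_iff_not_imp_right.mpr fun hc => ?_⟩
  -- With `a = 0` the quotient is `z (b + c z^q)`. The substitution `w = z^q` shows that `b + c w`
  -- permutes the norm 1 group, and summing again gives `b = 0`.
  have himage2 : (normOneFinset F K hK).image (fun w => b + c * w) = normOneFinset F K hK := by
    apply Finset.eq_of_subset_of_card_le
    · intro m hm
      simp only [Finset.mem_image, mem_normOneFinset] at hm ⊢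
      obtain ⟨w, hw, rfl⟩ := hm
      have hw2 : cubicNorm F (frob F (frob F w)) = 1 := by
        rw [cubicNorm_frob hK, cubicNorm_frob hK, hw]
      have h1 := hmaps (frob F (frob F w)) hw2
      rw [ha, frob_frob_frob hK] at h1
      have h2 : 0 + b * frob F (frob F w) + c * (frob F (frob F w) * w) =
          frob F (frob F w) * (b + c * w) := by ring
      rwa [h2, cubicNorm_mul, hw2, one_mul] at h1
    · rw [Finset.card_image_of_injective]
      intro x y hxy
      simpa [hc] using hxy
  have := sum_of_permutes_normOneFinset hK himage2
  rwa [Finset.sum_add_distrib, ← Finset.mul_sum, sum_normOneFinset_id, Finset.sum_const,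
    nsmul_eq_mul, card_normOneFinset_cast, mul_zero, add_zero, one_mul] at this

/-- The plane is the graph of an `F`-linear map. Covering the same points makes this map
norm-preserving; meeting every plane of the family makes its quotient by `x` take all values of norm
1. -/
theorem mem_twist_of_mem_cover {X : Set (Submodule F (Fin 6 → F))} (hX : IsCover (normPlanes e) X)
    {U : Submodule F (Fin 6 → F)} (hU : U ∈ X) :
    U ∈ normPlanes (twist hK e) ∨ U ∈ normPlanes (twist hK (twist hK e)) := by
  obtain ⟨-, hplane, -, hpts, hmeet⟩ := hX
  have hcov (x y : K) (h : (x, y) ≠ 0) (hxy : e (x, y) ∈ U) :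
      x ≠ 0 ∧ cubicNorm F x = cubicNorm F y := by
    rw [← exists_normPlanes_iff h]
    exact (hpts _ (by rwa [ne_eq, LinearEquiv.map_eq_zero_iff])).mpr ⟨U, hU, hxy⟩
  have h0 (y : K) (hy : e (0, y) ∈ U) : y = 0 := by
    by_contra h
    exact (hcov 0 y (by simp [Prod.ext_iff, h]) hy).1 rfl
  obtain ⟨f, hf⟩ := exists_graph_of_isProjPlane (hplane U hU) h0 hK
  obtain ⟨a, b, c, habc⟩ := exists_frob_expansion hK f
  have hne (x : K) (y : K) (hx : x ≠ 0) : (x, y) ≠ 0 := fun h => hx (congrArg Prod.fst h)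
  have hnorm (x : K) (hx : x ≠ 0) :
      cubicNorm F (a * x + b * frob F x + c * frob F (frob F x)) = cubicNorm F x := by
    rw [← habc]
    exact (hcov _ _ (hne _ _ hx) (hf x)).2.symm
  have hsurj (m : K) (hm : cubicNorm F m = 1) :
      ∃ x : K, x ≠ 0 ∧ a * x + b * frob F x + c * frob F (frob F x) = x * m := by
    have h1 : kLine e (1, m) ⊓ U ≠ ⊥ := by
      intro h
      have := hmeet _ ⟨m, hm, rfl⟩ U hU
      change Module.finrank F (kLine e (1, m) ⊓ U : Submodule F (Fin 6 → F)) = 1 at this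
      rw [h] at this
      simp at this
    obtain ⟨v, hv, hvm, hvU⟩ := meets_iff.mp h1
    obtain ⟨x, hx, rfl⟩ := exists_smul_of_mem_kLine hvm hv
    simp only [Prod.smul_mk, smul_eq_mul, mul_one] at hvU
    refine ⟨x, hx, ?_⟩
    have h2 := sub_mem hvU (hf x)
    rw [← map_sub, Prod.mk_sub_mk, sub_self] at h2
    rw [← habc]
    exact (sub_eq_zero.mp (h0 _ h2)).symm
  obtain ⟨rfl, hbc⟩ := frob_expansion_of_permutes hK hsurj hnorm
  have : FiniteDimensional F U := inferInstance
  rcases hbc with rfl | rfl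
  · right
    have hc : cubicNorm F c = 1 := by simpa [cubicNorm_one] using hnorm 1 one_ne_zero
    -- The slope is `c^q` because the double twist raises it to the power `q²`, which gives back
    -- `c`.
    refine ⟨frob F c, by change cubicNorm F _ = 1; rw [cubicNorm_frob hK, hc], ?_⟩
    refine Submodule.eq_of_le_of_finrank_eq ?_
      ((isProjPlane_kLine hK (mk_one_ne_zero _)).trans (hplane U hU).symm)
    intro v hv
    obtain ⟨x, rfl⟩ := mem_kLine.mp hv
    simp only [Prod.smul_mk, smul_eq_mul, mul_one, twist_apply, map_mul, frob_frob_frob hK]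
    have := hf x
    rwa [habc, zero_mul, zero_mul, zero_add, zero_add, mul_comm] at this
  · left
    have hb : cubicNorm F b = 1 := by simpa [cubicNorm_one] using hnorm 1 one_ne_zero
    refine ⟨frob F (frob F b), by
      change cubicNorm F _ = 1; rw [cubicNorm_frob hK, cubicNorm_frob hK, hb], ?_⟩
    refine Submodule.eq_of_le_of_finrank_eq ?_
      ((isProjPlane_kLine hK (mk_one_ne_zero _)).trans (hplane U hU).symm)
    intro v hv
    obtain ⟨x, rfl⟩ := mem_kLine.mp hv
    simp only [Prod.smul_mk, smul_eq_mul, mul_one, twist_apply, map_mul, frob_frob_frob hK]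
    have := hf x
    rwa [habc, zero_mul, zero_mul, zero_add, add_zero, mul_comm] at this

theorem isCover_normPlanes_iff {X : Set (Submodule F (Fin 6 → F))} :
    IsCover (normPlanes e) X ↔
      X = normPlanes (twist hK e) ∨ X = normPlanes (twist hK (twist hK e)) := by
  constructor
  · intro hX
    have hfin : Finite (Submodule F (Fin 6 → F)) := inferInstance
    have hsub : X ⊆ normPlanes (twist hK e) ∨ X ⊆ normPlanes (twist hK (twist hK e)) := by
      by_contra! h
      obtain ⟨U, hU, hU1⟩ := Set.not_subset.mp h.1
      obtain ⟨W, hW, hW1⟩ := Set.not_subset.mp h.2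
      have hU2 := (mem_twist_of_mem_cover hK hX hU).resolve_left hU1
      have hW2 := (mem_twist_of_mem_cover hK hX hW).resolve_right hW1
      have hne : W ≠ U := fun h => hW1 (h ▸ hU2)
      obtain ⟨n, hn, rfl⟩ := hU2
      obtain ⟨m, hm, rfl⟩ := hW2
      exact hX.2.2.1 _ hW _ hU hne (meets_twist hK hm hn)
    refine hsub.imp (fun h => ?_) (fun h => ?_)
    all_goals
      refine Set.eq_of_subset_of_ncard_le h ?_ (Set.toFinite _)
      rw [ncard_normPlanes hK, hX.1]
  · rintro (rfl | rfl)
    · exact isCover_twist hK e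
    · exact isCover_twist_twist hK e

end Covers

-- Desarguesian spreads are regular, and sublines give reguli.

section RegularSpreads

variable {F K : Type*} [Field F] [Field K] [Algebra F K]
variable {e : (K × K) ≃ₗ[F] (Fin 6 → F)}

/-- The regular spread of the planes that represent the points of `PG(1,q³)`. -/
def desarguesianSpread (e : (K × K) ≃ₗ[F] (Fin 6 → F)) : Set (Submodule F (Fin 6 → F)) :=
  {U | ∃ a : K × K, a ≠ 0 ∧ U = kLine e a}

theorem isTwoSpread_desarguesianSpread (hK : Module.finrank F K = 3) :
    IsTwoSpread (desarguesianSpread e) := by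
  constructor
  · rintro _ ⟨a, ha, rfl⟩
    exact isProjPlane_kLine hK ha
  · intro v hv
    refine ⟨kLine e (e.symm v), ⟨⟨_, by simpa using hv, rfl⟩, ?_⟩, ?_⟩
    · simpa using apply_mem_kLine (e := e) (e.symm v)
    · rintro _ ⟨⟨a, ha, rfl⟩, h⟩
      exact kLine_eq_of_mem hv h (by simpa using apply_mem_kLine (e := e) (e.symm v))

theorem eq_zero_of_det_ne_zero {a b : K × K} (h : a.1 * b.2 ≠ a.2 * b.1) {x y : K}
    (hxy : x • a + y • b = 0) : x = 0 ∧ y = 0 := by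
  have h1 : x * a.1 + y * b.1 = 0 := congrArg Prod.fst hxy
  have h2 : x * a.2 + y * b.2 = 0 := congrArg Prod.snd hxy
  have h0 : a.1 * b.2 - a.2 * b.1 ≠ 0 := sub_ne_zero.mpr h
  constructor
  · refine (mul_eq_zero.mp ?_).resolve_right h0
    linear_combination b.2 * h1 - b.1 * h2
  · refine (mul_eq_zero.mp ?_).resolve_right h0
    linear_combination a.1 * h2 - a.2 * h1

/-- Cramer's rule: `det(a,b) c = det(c,b) a + det(a,c) b`. -/
theorem exists_frame {a b c : K × K} (ha : a ≠ 0) (hb : b ≠ 0) (hc : c ≠ 0)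
    (hab : kLine e a ≠ kLine e b) (hac : kLine e a ≠ kLine e c) (hbc : kLine e b ≠ kLine e c) :
    ∃ a' b' : K × K, a'.1 * b'.2 ≠ a'.2 * b'.1 ∧ kLine e a' = kLine e a ∧
      kLine e b' = kLine e b ∧ kLine e (a' + b') = kLine e c := by
  rw [ne_eq, kLine_eq_iff_det ha hb] at hab
  rw [ne_eq, kLine_eq_iff_det ha hc] at hac
  rw [ne_eq, kLine_eq_iff_det hb hc] at hbc
  have hab' : a.1 * b.2 - a.2 * b.1 ≠ 0 := sub_ne_zero.mpr hab
  have hac' : a.1 * c.2 - a.2 * c.1 ≠ 0 := sub_ne_zero.mpr hac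
  have hbc' : c.1 * b.2 - c.2 * b.1 ≠ 0 := fun h => hbc (by linear_combination -h)
  refine ⟨(c.1 * b.2 - c.2 * b.1) • a, (a.1 * c.2 - a.2 * c.1) • b, ?_, kLine_smul hbc' a,
    kLine_smul hac' b, ?_⟩
  · simp only [Prod.smul_fst, Prod.smul_snd, smul_eq_mul]
    intro h
    apply mul_ne_zero (mul_ne_zero hbc' hac') hab'
    linear_combination h
  · rw [← kLine_smul hab' c]
    congr 1
    refine Prod.ext ?_ ?_
    · simp only [Prod.fst_add, Prod.smul_fst, smul_eq_mul]; ring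
    · simp only [Prod.snd_add, Prod.smul_snd, smul_eq_mul]; ring

theorem algebraMap_injective (F K : Type*) [Field F] [Field K] [Algebra F K] :
    Function.Injective (algebraMap F K) := (algebraMap F K).injective

/-- In a frame with third point `a' + b'`, the line joining `x a'` and `x b'` meets three planes of
the regulus, hence also `D`. The coefficient so obtained does not depend on `x`, which makes `D` a
line over `K`. -/
theorem subset_desarguesianSpread_of_isTwoRegulus (hK : Module.finrank F K = 3)
    {a b c : K × K} (ha : a ≠ 0) (hb : b ≠ 0) (hc : c ≠ 0)
    (hab : kLine e a ≠ kLine e b) (hac : kLine e a ≠ kLine e c) (hbc : kLine e b ≠ kLine e c)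
    {R : Set (Submodule F (Fin 6 → F))} (hR : IsTwoRegulus R) (haR : kLine e a ∈ R)
    (hbR : kLine e b ∈ R) (hcR : kLine e c ∈ R) : R ⊆ desarguesianSpread e := by
  obtain ⟨a', b', hdet, ha', hb', hc'⟩ := exists_frame ha hb hc hab hac hbc
  obtain ⟨-, hplane, hdisj, htrans⟩ := hR
  intro D hD
  by_cases hDa : D = kLine e a
  · exact ⟨a, ha, hDa⟩
  by_cases hDb : D = kLine e b
  · exact ⟨b, hb, hDb⟩
  have hDa0 (x : K) (hx : e (x • a') ∈ D) : x = 0 := by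
    by_contra h
    refine hdisj D hD _ haR hDa (meets_iff.mpr ⟨_, ?_, hx, ha' ▸ smul_mem_kLine a' x⟩)
    intro h1
    rw [LinearEquiv.map_eq_zero_iff] at h1
    exact h (eq_zero_of_det_ne_zero hdet (x := x) (y := 0) (by simp [h1])).1
  have hDb0 (x : K) (hx : e (x • b') ∈ D) : x = 0 := by
    by_contra h
    refine hdisj D hD _ hbR hDb (meets_iff.mpr ⟨_, ?_, hx, hb' ▸ smul_mem_kLine b' x⟩)
    intro h1
    rw [LinearEquiv.map_eq_zero_iff] at h1
    exact h (eq_zero_of_det_ne_zero hdet (x := 0) (y := x) (by simp [h1])).2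
  have key (x : K) (hx : x ≠ 0) : ∃ t : F, e (x • a' + (algebraMap F K t * x) • b') ∈ D := by
    have hind : LinearIndependent F ![e (x • a'), e (x • b')] := by
      rw [LinearIndependent.pair_iff]
      intro s t hst
      rw [← map_smul, ← map_smul, ← map_add, LinearEquiv.map_eq_zero_iff,
        ← algebraMap_smul K s, ← algebraMap_smul K t, smul_smul, smul_smul] at hst
      have := eq_zero_of_det_ne_zero hdet hst
      simpa [hx] using this
    have hne (p : K × K) (hp : p = x • a' ∨ p = x • b' ∨ p = x • (a' + b')) : e p ≠ 0 := by
      intro h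
      rw [LinearEquiv.map_eq_zero_iff] at h
      subst h
      rcases hp with h | h | h
      · exact hx (eq_zero_of_det_ne_zero hdet (x := x) (y := 0) (by simp [← h])).1
      · exact hx (eq_zero_of_det_ne_zero hdet (x := 0) (y := x) (by simp [← h])).2
      · exact hx (eq_zero_of_det_ne_zero hdet (x := x) (y := x) (by rw [← smul_add, ← h])).1
    have hl : IsProjLine (Submodule.span F {e (x • a'), e (x • b')}) := by
      have h1 := finrank_span_eq_card hind
      rw [Matrix.range_cons, Matrix.range_cons, Matrix.range_empty, Set.union_empty,
        Set.singleton_union] at h1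
      exact h1
    have hmeet := htrans _ hl ⟨_, haR, _, hbR, _, hcR, hab, hac, hbc,
      meets_iff.mpr ⟨_, hne _ (Or.inl rfl), Submodule.subset_span (by simp),
        ha' ▸ smul_mem_kLine a' x⟩,
      meets_iff.mpr ⟨_, hne _ (Or.inr (Or.inl rfl)), Submodule.subset_span (by simp),
        hb' ▸ smul_mem_kLine b' x⟩,
      meets_iff.mpr ⟨_, hne _ (Or.inr (Or.inr rfl)),
        Submodule.mem_span_pair.mpr ⟨1, 1, by rw [smul_add, map_add, one_smul, one_smul]⟩,
        hc' ▸ smul_mem_kLine (a' + b') x⟩⟩ D hD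
    obtain ⟨v, hv0, hvl, hvD⟩ := meets_iff.mp hmeet
    obtain ⟨s, t, rfl⟩ := Submodule.mem_span_pair.mp hvl
    have hs : s ≠ 0 := by
      rintro rfl
      rw [zero_smul, zero_add] at hvD hv0
      have ht : t ≠ 0 := fun h => hv0 (by rw [h, zero_smul])
      rw [Submodule.smul_mem_iff _ ht] at hvD
      exact hx (hDb0 x hvD)
    refine ⟨s⁻¹ * t, ?_⟩
    have h1 := Submodule.smul_mem D s⁻¹ hvD
    rw [smul_add, smul_smul, smul_smul, inv_mul_cancel₀ hs, one_smul, ← map_smul, ← map_add,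
      ← algebraMap_smul K (s⁻¹ * t), smul_smul] at h1
    exact h1
  obtain ⟨t, ht⟩ := key 1 one_ne_zero
  have hall (x : K) : e (x • (a' + algebraMap F K t • b')) ∈ D := by
    by_cases hx : x = 0
    · simp [hx]
    obtain ⟨s, hs⟩ := key x hx
    -- Independence of `x` comes from adding the points of `D` for `x` and `1` and comparing with
    -- the one for `x + 1`; `D` contains no nonzero multiple of `b'`.
    suffices h : s = t by
      rw [h] at hs
      rwa [smul_add, smul_smul, mul_comm]
    have hinj := algebraMap_injective F K
    by_cases hx1 : x + 1 = 0
    · have h1 := add_mem hs ht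
      rw [← map_add] at h1
      have h2 : x • a' + (algebraMap F K s * x) • b' + ((1 : K) • a' + (algebraMap F K t * 1) • b')
          = (algebraMap F K s * x + algebraMap F K t) • b' := by
        have : x • a' + (1 : K) • a' = 0 := by rw [← add_smul, hx1, zero_smul]
        rw [add_add_add_comm, this, zero_add, ← add_smul, mul_one]
      rw [h2] at h1
      have h3 := hDb0 _ h1
      rw [eq_neg_of_add_eq_zero_left hx1] at h3
      exact hinj (by linear_combination -h3)
    · obtain ⟨r, hr⟩ := key (x + 1) hx1
      have h1 := sub_mem hr (add_mem hs ht)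
      rw [← map_add, ← map_sub] at h1
      have h2 : (x + 1) • a' + (algebraMap F K r * (x + 1)) • b' -
          (x • a' + (algebraMap F K s * x) • b' + ((1 : K) • a' + (algebraMap F K t * 1) • b'))
          = (algebraMap F K (r - s) * x + algebraMap F K (r - t)) • b' := by
        simp only [map_sub]
        module
      rw [h2] at h1
      have h3 := hDb0 _ h1
      by_cases hrs : r = s
      · rw [hrs, sub_self, map_zero, zero_mul, zero_add, map_eq_zero, sub_eq_zero] at h3
        exact h3
      -- If the coefficients differ, the relation puts `x` in `F`; then `x` times the point for `1`
      -- is available in `D` for comparison.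
      · have hrs' : algebraMap F K (r - s) ≠ 0 := by
          rwa [ne_eq, map_eq_zero, sub_eq_zero]
        obtain ⟨f, rfl⟩ : ∃ f : F, algebraMap F K f = x := by
          refine ⟨-(r - t) / (r - s), ?_⟩
          rw [map_div₀, map_neg, div_eq_iff hrs']
          linear_combination -h3
        have hf0 : f ≠ 0 := by
          rintro rfl
          exact hx (map_zero _)
        have h4 := Submodule.smul_mem D f ht
        rw [← map_smul, ← algebraMap_smul K f] at h4
        have h5 := sub_mem hs h4
        rw [← map_sub] at h5
        have h6 : algebraMap F K f • a' + (algebraMap F K s * algebraMap F K f) • b' -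
            algebraMap F K f • ((1 : K) • a' + (algebraMap F K t * 1) • b') =
            (algebraMap F K ((s - t) * f)) • b' := by
          simp only [map_mul, map_sub]
          module
        rw [h6] at h5
        have h7 := hDb0 _ h5
        rw [map_eq_zero] at h7
        exact sub_eq_zero.mp ((mul_eq_zero.mp h7).resolve_right hf0)
  have hne : a' + algebraMap F K t • b' ≠ 0 := by
    intro h
    have := eq_zero_of_det_ne_zero hdet (x := 1) (y := algebraMap F K t) (by simpa using h)
    exact one_ne_zero this.1
  refine ⟨_, hne, (Submodule.eq_of_le_of_finrank_eq ?_
    ((isProjPlane_kLine hK hne).trans (hplane D hD).symm)).symm⟩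
  intro v hv
  obtain ⟨x, rfl⟩ := mem_kLine.mp hv
  exact hall x

theorem isRegularTwoSpread_desarguesianSpread (hK : Module.finrank F K = 3)
    (e : (K × K) ≃ₗ[F] (Fin 6 → F)) : IsRegularTwoSpread (desarguesianSpread e) := by
  refine ⟨isTwoSpread_desarguesianSpread hK, ?_⟩
  rintro _ ⟨a, ha, rfl⟩ _ ⟨b, hb, rfl⟩ _ ⟨c, hc, rfl⟩ hab hac hbc R hR haR hbR hcR
  exact subset_desarguesianSpread_of_isTwoRegulus hK ha hb hc hab hac hbc hR haR hbR hcR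

/-- The planes that represent the points of an order-`q`-subline of `PG(1,q³)`. -/
def subline (e : (K × K) ≃ₗ[F] (Fin 6 → F)) (a b : K × K) : Set (Submodule F (Fin 6 → F)) :=
  {U | ∃ s t : F, (s ≠ 0 ∨ t ≠ 0) ∧ U = kLine e (s • a + t • b)}

theorem smul_add_smul_eq_zero {a b : K × K} (hdet : a.1 * b.2 ≠ a.2 * b.1) {s t : F}
    (h : s • a + t • b = 0) : s = 0 ∧ t = 0 := by
  rw [← algebraMap_smul K s, ← algebraMap_smul K t] at h
  have := eq_zero_of_det_ne_zero hdet h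
  simpa using this

theorem smul_add_smul_ne_zero {a b : K × K} (hdet : a.1 * b.2 ≠ a.2 * b.1) {s t : F}
    (h : s ≠ 0 ∨ t ≠ 0) : s • a + t • b ≠ 0 := by
  intro h0
  have := smul_add_smul_eq_zero hdet h0
  tauto

theorem kLine_subline_eq_iff {a b : K × K} (hdet : a.1 * b.2 ≠ a.2 * b.1) {s t s' t' : F}
    (h : s ≠ 0 ∨ t ≠ 0) (h' : s' ≠ 0 ∨ t' ≠ 0) :
    kLine e (s • a + t • b) = kLine e (s' • a + t' • b) ↔ s * t' = t * s' := by
  rw [kLine_eq_iff_det (smul_add_smul_ne_zero hdet h) (smul_add_smul_ne_zero hdet h')]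
  have h0 : a.1 * b.2 - a.2 * b.1 ≠ 0 := sub_ne_zero.mpr hdet
  rw [← (algebraMap_injective F K).eq_iff, ← sub_eq_zero,
    ← sub_eq_zero (a := algebraMap F K (s * t'))]
  simp only [Prod.fst_add, Prod.snd_add, Prod.smul_fst, Prod.smul_snd]
  simp only [Algebra.smul_def, map_mul]
  constructor <;> intro h
  · refine (mul_eq_zero.mp ?_).resolve_right h0
    linear_combination h
  · linear_combination (a.1 * b.2 - a.2 * b.1) * h

theorem subline_eq_insert (a b : K × K) : subline e a b =
    insert (kLine e b) (Set.range fun t : F => kLine e (a + t • b)) := by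
  ext U
  constructor
  · rintro ⟨s, t, hst, rfl⟩
    by_cases hs : s = 0
    · left
      have ht : algebraMap F K t ≠ 0 := by simpa [hs] using hst
      rw [hs, zero_smul, zero_add, ← algebraMap_smul K t, kLine_smul ht]
    · right
      refine ⟨s⁻¹ * t, ?_⟩
      have hs' : algebraMap F K s ≠ 0 := by simpa using hs
      simp only
      rw [← kLine_smul hs', algebraMap_smul, smul_add, smul_smul, mul_inv_cancel_left₀ hs]
  · rintro (rfl | ⟨t, rfl⟩)
    · exact ⟨0, 1, by simp, by simp⟩
    · exact ⟨1, t, by simp, by simp⟩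

/-- Points `xᵢ (sᵢ a + tᵢ b)` of one line in three planes are dependent over `F`, which forces `x₂`
to be an `F`-multiple of `x₁`. The line then contains every `x₁ (s a + t b)`. -/
theorem isTwoRegulus_subline [Finite F] (hK : Module.finrank F K = 3) {a b : K × K}
    (hdet : a.1 * b.2 ≠ a.2 * b.1) : IsTwoRegulus (subline e a b) := by
  refine ⟨?_, ?_, ?_, ?_⟩
  · have hinj : Function.Injective fun t : F => kLine e (a + t • b) := by
      intro s t h
      have := (kLine_subline_eq_iff (e := e) hdet (s := 1) (t := s) (s' := 1) (t' := t)
        (by simp) (by simp)).mp (by simpa using h)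
      simpa using this.symm
    have hnot : kLine e b ∉ Set.range fun t : F => kLine e (a + t • b) := by
      rintro ⟨t, h⟩
      have := (kLine_subline_eq_iff (e := e) hdet (s := 1) (t := t) (s' := 0) (t' := 1)
        (by simp) (by simp)).mp (by simpa using h)
      simp at this
    rw [subline_eq_insert, Set.ncard_insert_of_notMem hnot (Set.finite_range _), ← Set.image_univ,
      Set.ncard_image_of_injective _ hinj, Set.ncard_univ]
  · rintro _ ⟨s, t, hst, rfl⟩
    exact isProjPlane_kLine hK (smul_add_smul_ne_zero hdet hst)
  · rintro _ ⟨s, t, hst, rfl⟩ _ ⟨s', t', hst', rfl⟩ h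
    exact not_meets_kLine h
  · rintro l hl ⟨_, ⟨s₁, t₁, h₁, rfl⟩, _, ⟨s₂, t₂, h₂, rfl⟩, _, ⟨s₃, t₃, h₃, rfl⟩, h12, h13, h23,
      m₁, m₂, m₃⟩
    rw [ne_eq, kLine_subline_eq_iff hdet h₁ h₂, ← sub_eq_zero] at h12
    rw [ne_eq, kLine_subline_eq_iff hdet h₁ h₃, ← sub_eq_zero] at h13
    rw [ne_eq, kLine_subline_eq_iff hdet h₂ h₃, ← sub_eq_zero] at h23
    obtain ⟨_, hv₁, hl₁, hm₁⟩ := meets_iff.mp m₁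
    obtain ⟨_, hv₂, hl₂, hm₂⟩ := meets_iff.mp m₂
    obtain ⟨_, hv₃, hl₃, hm₃⟩ := meets_iff.mp m₃
    obtain ⟨x₁, hx₁, rfl⟩ := exists_smul_of_mem_kLine hm₁ hv₁
    obtain ⟨x₂, hx₂, rfl⟩ := exists_smul_of_mem_kLine hm₂ hv₂
    obtain ⟨x₃, hx₃, rfl⟩ := exists_smul_of_mem_kLine hm₃ hv₃
    obtain ⟨g, hg, hg0⟩ : ∃ g : Fin 3 → F,
        g 0 • x₁ • (s₁ • a + t₁ • b) + g 1 • x₂ • (s₂ • a + t₂ • b) +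
          g 2 • x₃ • (s₃ • a + t₃ • b) = 0 ∧ ∃ i, g i ≠ 0 := by
      have hfin : FiniteDimensional F l := inferInstance
      let w : Fin 3 → l := ![⟨_, hl₁⟩, ⟨_, hl₂⟩, ⟨_, hl₃⟩]
      have hdep : ¬ LinearIndependent F w := by
        intro h
        have := h.fintype_card_le_finrank
        have hl2 : Module.finrank F l = 2 := hl
        rw [Fintype.card_fin, hl2] at this
        omega
      obtain ⟨g, hg, i, hi⟩ := Fintype.not_linearIndependent_iff.mp hdep
      refine ⟨g, ?_, i, hi⟩
      rw [Fin.sum_univ_three] at hg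
      have h1 : g 0 • e (x₁ • (s₁ • a + t₁ • b)) + g 1 • e (x₂ • (s₂ • a + t₂ • b)) +
        g 2 • e (x₃ • (s₃ • a + t₃ • b)) = 0 := congrArg Subtype.val hg
      rw [← map_smul, ← map_smul, ← map_smul, ← map_add, ← map_add,
        LinearEquiv.map_eq_zero_iff] at h1
      exact h1
    set A := algebraMap F K with hA
    have hrel : (A (g 0) * x₁ * A s₁ + A (g 1) * x₂ * A s₂ + A (g 2) * x₃ * A s₃) • a +
        (A (g 0) * x₁ * A t₁ + A (g 1) * x₂ * A t₂ + A (g 2) * x₃ * A t₃) • b = 0 := by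
      have hsmul (f : F) (p : K × K) : f • p = A f • p := (algebraMap_smul K f p).symm
      rw [← hg]
      simp only [hsmul]
      module
    obtain ⟨hr1, hr2⟩ := eq_zero_of_det_ne_zero hdet hrel
    have e1 : A (g 0) * x₁ * A (s₁ * t₃ - t₁ * s₃) + A (g 1) * x₂ * A (s₂ * t₃ - t₂ * s₃) = 0 := by
      simp only [map_sub, map_mul]
      linear_combination A t₃ * hr1 - A s₃ * hr2
    have e2 : A (g 0) * x₁ * A (s₁ * t₂ - t₁ * s₂) - A (g 2) * x₃ * A (s₂ * t₃ - t₂ * s₃) = 0 := by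
      simp only [map_sub, map_mul]
      linear_combination A t₂ * hr1 - A s₂ * hr2
    have hA0 {f : F} (hf : f ≠ 0) : A f ≠ 0 := by simpa [hA] using hf
    have hg0' : g 0 ≠ 0 := by
      intro h
      rw [h, map_zero, zero_mul, zero_mul, zero_add] at e1
      rw [h, map_zero, zero_mul, zero_mul, zero_sub, neg_eq_zero] at e2
      have h1 : g 1 = 0 := by
        by_contra h1
        exact mul_ne_zero (mul_ne_zero (hA0 h1) hx₂) (hA0 h23) e1
      have h2 : g 2 = 0 := by
        by_contra h2
        exact mul_ne_zero (mul_ne_zero (hA0 h2) hx₃) (hA0 h23) e2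
      obtain ⟨i, hi⟩ := hg0
      fin_cases i
      · exact hi h
      · exact hi h1
      · exact hi h2
    have hg1' : g 1 ≠ 0 := by
      intro h
      rw [h, map_zero, zero_mul, zero_mul, add_zero] at e1
      exact mul_ne_zero (mul_ne_zero (hA0 hg0') hx₁) (hA0 h13) e1
    obtain ⟨f, hf⟩ : ∃ f : F, x₂ = A f * x₁ := by
      refine ⟨-(g 0 * (s₁ * t₃ - t₁ * s₃)) / (g 1 * (s₂ * t₃ - t₂ * s₃)), ?_⟩
      have hne := hA0 (mul_ne_zero hg1' h23)
      rw [map_div₀, div_mul_eq_mul_div, eq_div_iff hne]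
      simp only [map_neg, map_mul] at e1 ⊢
      linear_combination e1
    have hf0 : f ≠ 0 := by
      rintro rfl
      simp [hf] at hx₂
    rintro _ ⟨s, t, hst, rfl⟩
    refine meets_iff.mpr ⟨e (x₁ • (s • a + t • b)), ?_, ?_, smul_mem_kLine _ _⟩
    · rw [ne_eq, LinearEquiv.map_eq_zero_iff, smul_eq_zero, not_or]
      exact ⟨hx₁, smul_add_smul_ne_zero hdet hst⟩
    · have hδ : s₁ * t₂ - t₁ * s₂ ≠ 0 := h12
      -- The coefficients are Cramer's rule for `(s, t)` in terms of `(s₁, t₁)` and `(s₂, t₂)`,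
      -- corrected by `x₂ = f x₁`.
      have h1 := add_mem (Submodule.smul_mem l ((s * t₂ - t * s₂) / (s₁ * t₂ - t₁ * s₂)) hl₁)
        (Submodule.smul_mem l ((s₁ * t - t₁ * s) / (s₁ * t₂ - t₁ * s₂) / f) hl₂)
      rw [← map_smul, ← map_smul, ← map_add] at h1
      convert h1 using 2
      rw [hf, hA, mul_smul, algebraMap_smul, smul_comm f x₁, smul_comm _ x₁, smul_comm _ x₁,
        smul_smul _ f, div_mul_cancel₀ _ hf0, ← smul_add]
      congr 1
      simp only [smul_add, smul_smul]
      rw [add_add_add_comm, ← add_smul, ← add_smul]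
      congr 2
      all_goals
        rw [div_mul_eq_mul_div, div_mul_eq_mul_div, ← add_div, eq_div_iff hδ]
        ring

end RegularSpreads

-- Three norm 1 elements on an affine line over `F`.

section CollinearTriple

variable {F K : Type*} [Field F] [Finite F] [Field K] [Algebra F K]

/-- An irreducible cubic of the form `X (X + 1) (X + r) - c` has a root in a cubic extension. -/
theorem exists_root_of_cubic (hK : Module.finrank F K = 3) {r : F} :
    ∃ c : F, c ≠ 0 ∧ ∃ y : K, y * (y + 1) * (y + algebraMap F K r) = algebraMap F K c ∧
      frob F y ≠ y := by
  have hKfin := finite_cubic hK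
  -- On the finite field `F` this map takes the value 0 at both `0` and `-1`, so it also misses some
  -- value `c`; a cubic without roots is irreducible.
  let f : F → F := fun t => t * (t + 1) * (t + r)
  have hninj : ¬ Function.Injective f := by
    intro h
    have h1 : f 0 = f (-1) := by simp [f]
    exact one_ne_zero (neg_eq_zero.mp (h h1).symm)
  have hnsurj : ¬ Function.Surjective f := fun h => hninj (Finite.injective_iff_surjective.mpr h)
  rw [Function.Surjective] at hnsurj
  push Not at hnsurj
  obtain ⟨c, hc⟩ := hnsurj
  refine ⟨c, fun h => hc 0 (by simp [f, h]), ?_⟩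
  let p : Polynomial F := Polynomial.X ^ 3 + Polynomial.C (1 + r) * Polynomial.X ^ 2 +
    Polynomial.C r * Polynomial.X - Polynomial.C c
  have hdeg : p.natDegree = 3 := by
    simp only [p]
    compute_degree!
  have hirr : Irreducible p := by
    refine Polynomial.irreducible_of_degree_le_three_of_not_isRoot (by rw [hdeg]; decide)
      fun t ht => hc t ?_
    have : t ^ 3 + (1 + r) * t ^ 2 + r * t - c = 0 := by simpa [p] using! ht
    simp only [f]
    linear_combination this
  have hfact : Fact (Irreducible p) := ⟨hirr⟩
  have hfin : Module.finrank F (AdjoinRoot p) = 3 := by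
    rw [(AdjoinRoot.powerBasis hirr.ne_zero).finrank, AdjoinRoot.powerBasis_dim, hdeg]
  obtain ⟨φ⟩ := FiniteField.nonempty_algHom_of_finrank_dvd (F := F) (K := AdjoinRoot p) (L := K)
    (by rw [hfin, hK])
  have hroot : φ (AdjoinRoot.root p) * (φ (AdjoinRoot.root p) + 1) *
      (φ (AdjoinRoot.root p) + algebraMap F K r) = algebraMap F K c := by
    have h1 : Polynomial.aeval (φ (AdjoinRoot.root p)) p = 0 := by
      rw [Polynomial.aeval_algHom_apply, AdjoinRoot.aeval_eq, AdjoinRoot.mk_self, map_zero]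
    simp only [p, map_add, map_sub, map_mul, map_pow, Polynomial.aeval_X, Polynomial.aeval_C,
      map_one] at h1
    linear_combination h1
  refine ⟨φ (AdjoinRoot.root p), hroot, fun h => ?_⟩
  obtain ⟨t, ht⟩ := exists_algebraMap_of_frob_eq h
  rw [← ht] at hroot
  refine hc t (algebraMap_injective F K ?_)
  simpa [f] using hroot

/-- There are three elements of norm 1 on an affine line over the base field. -/
theorem exists_collinear_cubicNorm (hK : Module.finrank F K = 3) {r : F} :
    ∃ d : K, d ≠ 0 ∧ cubicNorm F (1 + d) = 1 ∧ cubicNorm F (1 + r • d) = 1 := by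
  obtain ⟨c, hc, y, hy, hyne⟩ := exists_root_of_cubic hK (r := r)
  have hc' : algebraMap F K c ≠ 0 := by simpa using hc
  have hy0 : y ≠ 0 := by
    rintro rfl
    simp at hyne
  have hz := congrArg (frob F) hy
  have hw := congrArg (frob F) hz
  simp only [map_mul, map_add, map_one, AlgHom.commutes] at hz hw
  have hn0 : cubicNorm F y = y * frob F y * frob F (frob F y) := rfl
  have hn1 : cubicNorm F (y + 1) = (y + 1) * (frob F y + 1) * (frob F (frob F y) + 1) := by
    simp [cubicNorm]
  have hnr : cubicNorm F (y + algebraMap F K r) =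
      (y + algebraMap F K r) * (frob F y + algebraMap F K r) *
        (frob F (frob F y) + algebraMap F K r) := by
    simp [cubicNorm]
  have h1 : y - frob F y ≠ 0 := fun h => hyne (sub_eq_zero.mp h).symm
  have h2 : frob F y - frob F (frob F y) ≠ 0 := fun h =>
    hyne (frob_injective (sub_eq_zero.mp h)).symm
  have h3 : y - frob F (frob F y) ≠ 0 := by
    intro h
    have := congrArg (frob F) (sub_eq_zero.mp h)
    rw [frob_frob_frob hK] at this
    exact hyne this
  set z := frob F y
  set w := frob F z
  set s := algebraMap F K r
  set c' := algebraMap F K c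
  -- Differences of the equations for the three distinct conjugates yield Vieta's relations. Since
  -- `X (X + 1) (X + r) - c` equals `-c` at `0`, `-1` and `-r`, the elements `y`, `y + 1`, `y + r`
  -- all have norm `c`; dividing by `y` gives the triple.
  have e1 : y ^ 2 + y * z + z ^ 2 + (1 + s) * (y + z) + s = 0 := by
    refine (mul_eq_zero.mp ?_).resolve_left h1
    linear_combination hy - hz
  have e2 : y ^ 2 + y * w + w ^ 2 + (1 + s) * (y + w) + s = 0 := by
    refine (mul_eq_zero.mp ?_).resolve_left h3
    linear_combination hy - hw
  have e3 : y + z + w + (1 + s) = 0 := by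
    refine (mul_eq_zero.mp ?_).resolve_left h2
    linear_combination e1 - e2
  have e4 : y * z + y * w + z * w = s := by
    linear_combination (y + z) * e3 - e1
  have e5 : y * z * w = c' := by
    linear_combination hy + y * e4 - y ^ 2 * e3
  have hN0 : cubicNorm F y = c' := by rw [hn0, e5]
  have hN1 : cubicNorm F (y + 1) = c' := by
    rw [hn1]
    linear_combination e5 + e4 + e3
  have hNr : cubicNorm F (y + s) = c' := by
    rw [hnr]
    linear_combination e5 + s * e4 + s ^ 2 * e3
  refine ⟨y⁻¹, inv_ne_zero hy0, ?_, ?_⟩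
  · have : 1 + y⁻¹ = (y + 1) / y := by field_simp
    rw [this, cubicNorm_div, hN0, hN1, div_self hc']
  · have : 1 + r • y⁻¹ = (y + s) / y := by
      rw [Algebra.smul_def]
      field_simp
      rfl
    rw [this, cubicNorm_div, hN0, hNr, div_self hc']

end CollinearTriple

-- Uniqueness of the regular spread containing the norm family.

section Uniqueness

variable {F K : Type*} [Field F] [Finite F] [Field K] [Algebra F K]
variable {e : (K × K) ≃ₗ[F] (Fin 6 → F)}

theorem normPlanes_subset_desarguesianSpread : normPlanes e ⊆ desarguesianSpread e := by
  rintro _ ⟨m, -, rfl⟩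
  exact ⟨_, mk_one_ne_zero m, rfl⟩

omit [Finite F] in
theorem eq_of_isTwoSpread_of_subset {𝒮 𝒯 : Set (Submodule F (Fin 6 → F))} (hS : IsTwoSpread 𝒮)
    (hT : IsTwoSpread 𝒯) (h : 𝒯 ⊆ 𝒮) : 𝒮 = 𝒯 := by
  refine Set.Subset.antisymm (fun U hU => ?_) h
  have hne : U ≠ ⊥ := by
    rintro rfl
    have := hS.1 _ hU
    simp [IsProjPlane] at this
  obtain ⟨v, hvU, hv⟩ := (Submodule.ne_bot_iff U).mp hne
  obtain ⟨W, ⟨hW, hvW⟩, -⟩ := hT.2 v hv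
  rwa [(hS.2 v hv).unique ⟨hU, hvU⟩ ⟨h hW, hvW⟩]

theorem subline_subset_of_mem (hK : Module.finrank F K = 3) {𝒮 : Set (Submodule F (Fin 6 → F))}
    (hS : IsRegularTwoSpread 𝒮) {a b : K × K} (hdet : a.1 * b.2 ≠ a.2 * b.1)
    {A B C : Submodule F (Fin 6 → F)} (hA : A ∈ subline e a b) (hB : B ∈ subline e a b)
    (hC : C ∈ subline e a b) (hAS : A ∈ 𝒮) (hBS : B ∈ 𝒮) (hCS : C ∈ 𝒮) (hAB : A ≠ B)
    (hAC : A ≠ C) (hBC : B ≠ C) : subline e a b ⊆ 𝒮 :=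
  hS.2 A hAS B hBS C hCS hAB hAC hBC _ (isTwoRegulus_subline hK hdet) hA hB hC

omit [Finite F] in
theorem kLine_mem_subline (k d : K) (t : F) : kLine e (1, k + t • d) ∈ subline e (1, k) (0, d) :=
  ⟨1, t, by simp, by simp⟩

omit [Finite F] in
theorem kLine_infinity_mem_subline (k : K) {d : K} (hd : d ≠ 0) :
    kLine e (0, 1) ∈ subline e (1, k) (0, d) := by
  refine ⟨0, 1, by simp, ?_⟩
  rw [← kLine_smul hd (0, 1)]
  simp

theorem kLine_infinity_mem_of_collinear (hK : Module.finrank F K = 3)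
    {𝒮 : Set (Submodule F (Fin 6 → F))} (hS : IsRegularTwoSpread 𝒮) {k d : K} (hd : d ≠ 0) {r : F}
    (hr0 : r ≠ 0) (hr1 : r ≠ 1) (h0 : kLine e (1, k) ∈ 𝒮) (h1 : kLine e (1, k + d) ∈ 𝒮)
    (hr : kLine e (1, k + r • d) ∈ 𝒮) : kLine e (0, 1) ∈ 𝒮 := by
  have m0 := kLine_mem_subline (e := e) k d 0
  have m1 := kLine_mem_subline (e := e) k d 1
  rw [zero_smul, add_zero] at m0
  rw [one_smul] at m1
  refine subline_subset_of_mem hK hS (by simpa using hd) m0 m1 (kLine_mem_subline (e := e) k d r) h0 h1 hr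
    (kLine_one_injective.ne ?_) (kLine_one_injective.ne ?_) (kLine_one_injective.ne ?_)
    (kLine_infinity_mem_subline k hd)
  · simpa using hd
  · simp [hr0, hd]
  · intro h
    have h2 : (r - 1) • d = 0 := by
      rw [sub_smul, one_smul]
      linear_combination -h
    rcases smul_eq_zero.mp h2 with h3 | h3
    · exact hr1 (sub_eq_zero.mp h3)
    · exact hd h3

/-- With `(0, 1)` available, two parameters already give three planes of a regulus, so the set of
parameters is closed under affine lines over `F`. -/
theorem kLine_mem_of_infinity_mem (hK : Module.finrank F K = 3)
    {𝒮 : Set (Submodule F (Fin 6 → F))} (hS : IsRegularTwoSpread 𝒮) (hinf : kLine e (0, 1) ∈ 𝒮)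
    {k k' : K} (h : kLine e (1, k) ∈ 𝒮) (h' : kLine e (1, k') ∈ 𝒮) (t : F) :
    kLine e (1, k + t • (k' - k)) ∈ 𝒮 := by
  by_cases hkk : k' - k = 0
  · rwa [hkk, smul_zero, add_zero]
  have m0 := kLine_mem_subline (e := e) k (k' - k) 0
  have m1 := kLine_mem_subline (e := e) k (k' - k) 1
  rw [zero_smul, add_zero] at m0
  rw [one_smul, add_sub_cancel] at m1
  refine subline_subset_of_mem hK hS (by simpa using hkk) m0 m1 (kLine_infinity_mem_subline k hkk) h h'
    hinf (kLine_one_injective.ne ?_) (kLine_one_ne _) (kLine_one_ne _)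
    (kLine_mem_subline (e := e) k (k' - k) t)
  intro h1
  exact hkk (by rw [h1, sub_self])

omit [Finite F] in
/-- A spread that contains the planes of the points `(1, k)` with `k ≠ 0` contains the plane of
`(0, 1)`. -/
theorem kLine_infinity_mem_of_forall (hK : Module.finrank F K = 3)
    {𝒮 : Set (Submodule F (Fin 6 → F))} (hS : IsTwoSpread 𝒮)
    (h : ∀ k : K, k ≠ 0 → kLine e (1, k) ∈ 𝒮) : kLine e (0, 1) ∈ 𝒮 := by
  have hne : e (0, 1) ≠ 0 := by
    rw [ne_eq, LinearEquiv.map_eq_zero_iff]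
    exact mk_zero_one_ne_zero
  obtain ⟨U, ⟨hU, hUv⟩, -⟩ := hS.2 _ hne
  -- Such a vector lies in a plane already known to belong to the spread and not containing `e (0,
  -- 1)`.
  have key (x y : K) (hx : x ≠ 0) (hy : y ≠ 0) : e (x, y) ∉ U := by
    intro hxy
    have h1 : e (x, y) ≠ 0 := by
      rw [ne_eq, LinearEquiv.map_eq_zero_iff]
      exact fun h => hx (congrArg Prod.fst h)
    have h2 : e (x, y) ∈ kLine e (1, y / x) := by
      rw [apply_mem_kLine_one]
      field_simp
    rw [(hS.2 _ h1).unique ⟨hU, hxy⟩ ⟨h _ (div_ne_zero hy hx), h2⟩, apply_mem_kLine_one,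
      zero_mul] at hUv
    exact one_ne_zero hUv
  suffices hUeq : U = kLine e (0, 1) by rwa [← hUeq]
  refine Submodule.eq_of_le_of_finrank_eq ?_
    ((hS.1 U hU).trans (isProjPlane_kLine hK mk_zero_one_ne_zero).symm)
  intro v hv
  obtain ⟨⟨x, y⟩, rfl⟩ := e.surjective v
  have hx : x = 0 := by
    by_contra hx
    by_cases hy : y = 0
    · subst hy
      have := add_mem hv hUv
      rw [← map_add, Prod.mk_add_mk, add_zero, zero_add] at this
      exact key x 1 hx one_ne_zero this
    · exact key x y hx hy hv
  subst hx
  exact mem_kLine.mpr ⟨y, by simp⟩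

/-- Over the field with two elements all nonzero elements have norm 1. -/
theorem cubicNorm_eq_one_of_forall (hK : Module.finrank F K = 3)
    (h : ∀ r : F, r = 0 ∨ r = 1) {k : K} (hk : k ≠ 0) : cubicNorm F k = 1 := by
  have hcard : Nat.card F = 2 := by
    refine le_antisymm ?_ (one_lt_card F)
    rw [← Set.ncard_univ]
    exact (Set.ncard_le_ncard (t := {0, 1}) (fun r _ => by simpa using h r)).trans
      ((Set.ncard_insert_le _ _).trans (by simp))
  have := finite_cubic hK
  let _ := Fintype.ofFinite K
  have hK8 : Fintype.card K = 8 := by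
    rw [← Nat.card_eq_fintype_card, card_cubic hK, hcard]
    norm_num
  have h7 := FiniteField.pow_card_sub_one_eq_one k hk
  rw [hK8] at h7
  rw [cubicNorm_eq_pow, hcard]
  exact h7

theorem kLine_infinity_mem (hK : Module.finrank F K = 3)
    {𝒮 : Set (Submodule F (Fin 6 → F))} (hS : IsRegularTwoSpread 𝒮) (h : normPlanes e ⊆ 𝒮) :
    kLine e (0, 1) ∈ 𝒮 := by
  by_cases hr : ∃ r : F, r ≠ 0 ∧ r ≠ 1
  · obtain ⟨r, hr0, hr1⟩ := hr
    obtain ⟨d, hd, h1, h2⟩ := exists_collinear_cubicNorm hK (r := r)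
    exact kLine_infinity_mem_of_collinear hK hS hd hr0 hr1 (h ⟨1, cubicNorm_one, rfl⟩)
      (h ⟨_, h1, rfl⟩) (h ⟨_, h2, rfl⟩)
  -- For `q = 2` an affine line has only two points, but every nonzero parameter already has norm 1.
  · have hr' : ∀ r : F, r = 0 ∨ r = 1 := fun r => by
      by_contra! h1
      exact hr ⟨r, h1⟩
    exact kLine_infinity_mem_of_forall hK hS.1 fun k hk =>
      h ⟨k, cubicNorm_eq_one_of_forall hK hr' hk, rfl⟩

omit [Finite F] in
/-- A spread that contains all the planes of the regular spread but one contains the last one. -/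
theorem kLine_mem_of_forall_ne (hK : Module.finrank F K = 3)
    {𝒮 : Set (Submodule F (Fin 6 → F))} (hS : IsTwoSpread 𝒮) {a : K × K} (ha : a ≠ 0)
    (h : ∀ b : K × K, b ≠ 0 → kLine e b ≠ kLine e a → kLine e b ∈ 𝒮) : kLine e a ∈ 𝒮 := by
  have hea : e a ≠ 0 := by rwa [ne_eq, LinearEquiv.map_eq_zero_iff]
  obtain ⟨U, ⟨hU, hUa⟩, -⟩ := hS.2 _ hea
  suffices hUeq : U = kLine e a by rwa [← hUeq]
  refine Submodule.eq_of_le_of_finrank_eq ?_ ((hS.1 U hU).trans (isProjPlane_kLine hK ha).symm)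
  intro v hv
  obtain ⟨b, rfl⟩ := e.surjective v
  by_cases hb : b = 0
  · simp [hb]
  by_cases hba : kLine e b = kLine e a
  · rw [← hba]
    exact apply_mem_kLine b
  have heb : e b ≠ 0 := by rwa [ne_eq, LinearEquiv.map_eq_zero_iff]
  have hUb := (hS.2 _ heb).unique ⟨hU, hv⟩ ⟨h b hb hba, apply_mem_kLine b⟩
  rw [hUb] at hUa
  exact absurd (kLine_eq_of_mem hea hUa (apply_mem_kLine a)) hba

/-- A set of elements of a cubic extension that contains the line through any two of its points and
all the elements of norm 1 contains all elements, when the base field has at least 3 elements. -/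
theorem forall_of_closed_under_lines (hK : Module.finrank F K = 3) {P : K → Prop} {r : F}
    (hr0 : r ≠ 0) (hr1 : r ≠ 1) (hnorm : ∀ m, cubicNorm F m = 1 → P m)
    (hline : ∀ k k', P k → P k' → ∀ t : F, P (k + t • (k' - k))) (k : K) : P k := by
  have hfin := finite_cubic hK
  have hdim : FiniteDimensional F K := FiniteDimensional.of_finrank_pos (by omega)
  have h1 : P 1 := hnorm 1 cubicNorm_one
  have hsmul (t : F) (x : K) (hx : P (1 + x)) : P (1 + t • x) := by
    simpa using hline 1 (1 + x) h1 hx t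
  let Q : Submodule F K :=
    { carrier := {x | P (1 + x)}
      zero_mem' := by simpa using h1
      smul_mem' := hsmul
      add_mem' := fun {x y} hx hy => by
        -- The weights `1 - r` and `r` of the affine combination are cancelled beforehand, which
        -- needs `r` different from 0 and 1.
        have h2 := hline _ _ (hsmul (1 - r)⁻¹ x hx) (hsmul r⁻¹ y hy) r
        have hr1' : 1 - r ≠ 0 := sub_ne_zero.mpr hr1.symm
        have h3 : 1 + (1 - r)⁻¹ • x + r • (1 + r⁻¹ • y - (1 + (1 - r)⁻¹ • x)) = 1 + (x + y) := by
          have h4 : (1 - r) • (1 - r)⁻¹ • x = x := smul_inv_smul₀ hr1' x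
          have h5 : r • r⁻¹ • y = y := smul_inv_smul₀ hr0 y
          rw [sub_smul, one_smul] at h4
          simp only [smul_sub, smul_add] at *
          linear_combination h4 + h5
        rw [h3] at h2
        exact h2 }
  have hQ : Q = ⊤ := by
    by_contra hne
    have hlt := Submodule.finrank_lt hne
    rw [hK] at hlt
    have hcard : Nat.card Q = Nat.card F ^ Module.finrank F Q := Module.natCard_eq_pow_finrank
    -- A proper subspace has at most `q²` elements, fewer than the `q² + q + 1` translates `m - 1`
    -- that it must contain.
    have hle : Nat.card Q ≤ Nat.card F ^ 2 := by
      rw [hcard]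
      exact Nat.pow_le_pow_right (Nat.zero_lt_of_lt (one_lt_card F)) (by omega)
    have hge : {m : K | cubicNorm F m = 1}.ncard ≤ (Q : Set K).ncard := by
      refine Set.ncard_le_ncard_of_injOn (fun m => m - 1) (fun m hm => ?_)
        (fun x _ y _ hxy => by simpa using hxy)
      change P (1 + (m - 1))
      rw [add_sub_cancel]
      exact hnorm m hm
    rw [ncard_cubicNorm_eq_one F K hK, ← Nat.card_coe_set_eq] at hge
    have : Nat.card (Q : Set K) = Nat.card Q := rfl
    omega
  have hk : k - 1 ∈ Q := by rw [hQ]; trivial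
  have : P (1 + (k - 1)) := hk
  rwa [add_sub_cancel] at this

theorem desarguesianSpread_subset (hK : Module.finrank F K = 3)
    {𝒮 : Set (Submodule F (Fin 6 → F))} (hS : IsRegularTwoSpread 𝒮) (h : normPlanes e ⊆ 𝒮) :
    desarguesianSpread e ⊆ 𝒮 := by
  have hinf := kLine_infinity_mem hK hS h
  suffices hk : ∀ k : K, kLine e (1, k) ∈ 𝒮 by
    rintro _ ⟨a, ha, rfl⟩
    rcases kLine_eq_normal_form (e := e) ha with h1 | ⟨k, h1⟩
    · rwa [h1]
    · rw [h1]
      exact hk k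
  by_cases hr : ∃ r : F, r ≠ 0 ∧ r ≠ 1
  · obtain ⟨r, hr0, hr1⟩ := hr
    exact forall_of_closed_under_lines hK hr0 hr1 (fun m hm => h ⟨m, hm, rfl⟩)
      fun k k' hk hk' t => kLine_mem_of_infinity_mem hK hS hinf hk hk' t
  · have hr' : ∀ r : F, r = 0 ∨ r = 1 := fun r => by
      by_contra! h1
      exact hr ⟨r, h1⟩
    have hne (k : K) (hk : k ≠ 0) : kLine e (1, k) ∈ 𝒮 :=
      h ⟨k, cubicNorm_eq_one_of_forall hK hr' hk, rfl⟩
    intro k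
    by_cases hk : k = 0
    · subst hk
      refine kLine_mem_of_forall_ne hK hS.1 (mk_one_ne_zero 0) fun b hb hb1 => ?_
      rcases kLine_eq_normal_form (e := e) hb with h1 | ⟨k, h1⟩
      · rwa [h1]
      · rw [h1] at hb1 ⊢
        refine hne k ?_
        rintro rfl
        exact hb1 rfl
    · exact hne k hk

theorem existsUnique_isRegularTwoSpread (hK : Module.finrank F K = 3)
    (e : (K × K) ≃ₗ[F] (Fin 6 → F)) : ∃! 𝒮, IsRegularTwoSpread 𝒮 ∧ normPlanes e ⊆ 𝒮 := by
  refine ⟨desarguesianSpread e, ⟨isRegularTwoSpread_desarguesianSpread hK e,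
    normPlanes_subset_desarguesianSpread⟩, ?_⟩
  rintro 𝒮 ⟨hS, h⟩
  exact eq_of_isTwoSpread_of_subset hS.1 (isTwoSpread_desarguesianSpread hK)
    (desarguesianSpread_subset hK hS h)

end Uniqueness

-- Normal form of an exterior subplane and of its splash.

section NormalForm

variable {F K : Type*} [Field F] [Finite F] [Field K] [Algebra F K]

/-- The values `x ^ q - x` span a space of dimension at least 2 over the base field. -/
theorem exists_frob_sub_independent (hK : Module.finrank F K = 3) : ∃ y z : K,
    frob F (frob F y - y) * (frob F z - z) ≠ frob F (frob F z - z) * (frob F y - y) := by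
  by_contra! h
  obtain ⟨z, hz⟩ : ∃ z : K, frob F z - z ≠ 0 := by
    by_contra! h1
    have := (frob_independent (F := F) hK (a := -1) (b := 1) (c := 0) fun x => by
      linear_combination h1 x).2.1
    exact one_ne_zero this
  refine hz (frob_independent (F := F) hK (a := frob F (frob F z - z))
    (b := -(frob F z - z) - frob F (frob F z - z)) (c := frob F z - z) fun y => ?_).2.2
  have := h y z
  simp only [map_sub] at this ⊢
  linear_combination this

/-- Take `s`, `t` independent in the plane `Tr(c x) = 0`, which contains all `(y^q - y) / c`. The
cross product of their vectors of conjugates is proportional to that of `c`, so `w^(q²) / w = c^q /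
c^(q²)`, and `c` is chosen to make this `m`. -/
theorem exists_wedge_eq (hK : Module.finrank F K = 3) {m : K} (hm : cubicNorm F m = 1) :
    ∃ s t : K, frob F s * t - frob F t * s ≠ 0 ∧
      frob F (frob F (frob F s * t - frob F t * s)) = m * (frob F s * t - frob F t * s) := by
  have hm0 := ne_zero_of_cubicNorm hm
  obtain ⟨x, hx, hxm⟩ := exists_frob_eq_mul hK (m := m⁻¹) (by rw [cubicNorm_inv, hm, inv_one])
  obtain ⟨c, hc, hcm⟩ : ∃ c : K, c ≠ 0 ∧ frob F c = m * frob F (frob F c) := by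
    refine ⟨frob F (frob F x), frob_ne_zero (frob_ne_zero hx), ?_⟩
    rw [frob_frob_frob hK, hxm, mul_inv_cancel_left₀ hm0]
  obtain ⟨y, z, hyz⟩ := exists_frob_sub_independent (F := F) hK
  have hc1 := frob_ne_zero (F := F) hc
  have htr (y : K) : c * ((frob F y - y) / c) + frob F c * frob F ((frob F y - y) / c) +
      frob F (frob F c) * frob F (frob F ((frob F y - y) / c)) = 0 := by
    have hc2 := frob_ne_zero (F := F) hc1
    simp only [map_div₀]
    rw [mul_div_cancel₀ _ hc, mul_div_cancel₀ _ hc1, mul_div_cancel₀ _ hc2]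
    simp only [map_sub, frob_frob_frob hK]
    ring
  refine ⟨(frob F y - y) / c, (frob F z - z) / c, ?_, ?_⟩
  · have : frob F ((frob F y - y) / c) * ((frob F z - z) / c) -
        frob F ((frob F z - z) / c) * ((frob F y - y) / c) =
        (frob F (frob F y - y) * (frob F z - z) - frob F (frob F z - z) * (frob F y - y)) /
          (frob F c * c) := by
      rw [map_div₀, map_div₀]
      field_simp
    rw [this]
    exact div_ne_zero (sub_ne_zero.mpr hyz) (mul_ne_zero hc1 hc)
  · have hs := htr y
    have ht := htr z
    set s := (frob F y - y) / c
    set t := (frob F z - z) / c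
    apply mul_left_cancel₀ (frob_ne_zero (F := F) hc1)
    simp only [map_sub, map_mul, frob_frob_frob hK]
    linear_combination s * ht - t * hs + (frob F s * t - frob F t * s) * hcm

variable (F) in
/-- A coordinate of the points of the subplane with matrix `A`. -/
noncomputable def subplaneCoord (A : GL (Fin 3) K) (i : Fin 3) : (Fin 3 → F) →ₗ[F] K where
  toFun u := (A : Matrix (Fin 3) (Fin 3) K).mulVec (extVec K u) i
  map_add' u v := by
    have : extVec K (u + v) = extVec K u + extVec K v := by
      ext i
      simp [extVec]
    rw [this, Matrix.mulVec_add, Pi.add_apply]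
  map_smul' c u := by
    have : extVec K (c • u) = algebraMap F K c • extVec K u := by
      ext i
      simp [extVec]
    rw [this, Matrix.mulVec_smul, Pi.smul_apply, RingHom.id_apply, algebraMap_smul]

omit [Finite F] in
theorem subplaneCoord_apply (A : GL (Fin 3) K) (i : Fin 3) (u : Fin 3 → F) :
    subplaneCoord F A i u = (A : Matrix (Fin 3) (Fin 3) K).mulVec (extVec K u) i := rfl

omit [Finite F] in
theorem mulVec_extVec_ne_zero (A : GL (Fin 3) K) {u : Fin 3 → F} (hu : u ≠ 0) :
    (A : Matrix (Fin 3) (Fin 3) K).mulVec (extVec K u) ≠ 0 := by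
  intro h
  have hinj := Matrix.mulVec_injective_iff_isUnit.mpr A.isUnit
  have h0 := hinj (h.trans (Matrix.mulVec_zero _).symm)
  apply hu
  ext i
  have := congrFun h0 i
  simpa [extVec] using this

theorem submodule_eq_span {V : Type*} [AddCommGroup V] [Module K V] {P : ℙ K V} {v : V}
    (hv : v ≠ 0) (h : v ∈ P.submodule) : P.submodule = Submodule.span K {v} := by
  rw [Projectivization.submodule_eq] at h ⊢
  obtain ⟨c, rfl⟩ := Submodule.mem_span_singleton.mp h
  have hc : c ≠ 0 := by
    rintro rfl
    simp at hv
  exact (Submodule.span_singleton_smul_eq (IsUnit.mk0 c hc) _).symm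

theorem mem_submodule_mk {V : Type*} [AddCommGroup V] [Module K V] {v : V} (hv : v ≠ 0) :
    v ∈ (Projectivization.mk K v hv).submodule := by
  rw [Projectivization.submodule_mk]
  exact Submodule.mem_span_singleton_self v

omit [Finite F] in
theorem subplaneCoord_two_ne_zero {A : GL (Fin 3) K} (hext : IsExterior (subplane F A))
    {u : Fin 3 → F} (hu : u ≠ 0) : subplaneCoord F A 2 u ≠ 0 := by
  intro h
  have hv := mulVec_extVec_ne_zero A hu
  refine hext (Projectivization.mk K _ hv) ⟨u, hu, mem_submodule_mk hv⟩ ?_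
  intro x hx
  rw [Projectivization.submodule_mk, Submodule.mem_span_singleton] at hx
  obtain ⟨c, rfl⟩ := hx
  rw [subplaneCoord_apply] at h
  rw [Pi.smul_apply, h, smul_zero]

omit [Finite F] in
theorem eq_zero_of_forall_subplaneCoord {A : GL (Fin 3) K} {r : Fin 3 → K}
    (h : ∀ u : Fin 3 → F, r 0 * subplaneCoord F A 0 u + r 1 * subplaneCoord F A 1 u +
      r 2 * subplaneCoord F A 2 u = 0) : r = 0 := by
  have hinj := Matrix.vecMul_injective_iff_isUnit.mpr A.isUnit
  apply hinj
  simp only [Matrix.zero_vecMul]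
  ext j
  have h1 := h (Pi.single j 1)
  have h2 : extVec K (Pi.single j (1 : F)) = Pi.single j (1 : K) := by
    ext i
    by_cases hij : i = j
    · subst hij; simp [extVec]
    · simp [extVec, hij]
  simp only [subplaneCoord_apply, h2, Matrix.mulVec_single_one, Matrix.col_apply] at h1
  simpa [Matrix.vecMul, dotProduct, Fin.sum_univ_three] using h1

/-- Coordinates in which an exterior subplane is `{(t ^ q, t ^ (q ^ 2), t)}`. -/
theorem exists_subplane_coordinates (hK : Module.finrank F K = 3) {A : GL (Fin 3) K}
    (hext : IsExterior (subplane F A)) :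
    ∃ (τ : (Fin 3 → F) ≃ₗ[F] K) (g : (K × K) ≃ₗ[K] (K × K)),
      (∀ u, subplaneCoord F A 2 u = τ u) ∧ ∀ u v,
        (subplaneCoord F A 0 v * τ u - subplaneCoord F A 0 u * τ v,
          subplaneCoord F A 1 v * τ u - subplaneCoord F A 1 u * τ v) =
        g (frob F (τ v) * τ u - frob F (τ u) * τ v,
          frob F (frob F (frob F (τ v) * τ u - frob F (τ u) * τ v))) := by
  have : Module.Finite F K := Module.finite_of_finrank_pos (by omega)
  have hinj : Function.Injective (subplaneCoord F A 2) := by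
    rw [← LinearMap.ker_eq_bot, LinearMap.ker_eq_bot']
    intro u hu
    by_contra h
    exact subplaneCoord_two_ne_zero hext h hu
  let τ := LinearEquiv.ofInjectiveOfFinrankEq (subplaneCoord F A 2) hinj (by rw [hK]; simp)
  have hτ (u : Fin 3 → F) : subplaneCoord F A 2 u = τ u := rfl
  obtain ⟨a₀, b₀, c₀, h₀⟩ := exists_frob_expansion hK
    (subplaneCoord F A 0 ∘ₗ (τ.symm : K →ₗ[F] (Fin 3 → F)))
  obtain ⟨a₁, b₁, c₁, h₁⟩ := exists_frob_expansion hK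
    (subplaneCoord F A 1 ∘ₗ (τ.symm : K →ₗ[F] (Fin 3 → F)))
  have h₀' (u : Fin 3 → F) : subplaneCoord F A 0 u =
      a₀ * τ u + b₀ * frob F (τ u) + c₀ * frob F (frob F (τ u)) := by
    rw [← h₀]; simp
  have h₁' (u : Fin 3 → F) : subplaneCoord F A 1 u =
      a₁ * τ u + b₁ * frob F (τ u) + c₁ * frob F (frob F (τ u)) := by
    rw [← h₁]; simp
  -- Otherwise a nontrivial combination of the first two rows of `A` would be a multiple of the
  -- third.
  have hrow (r s : K) (hb : r * b₀ + s * b₁ = 0) (hc : r * c₀ + s * c₁ = 0) : r = 0 ∧ s = 0 := by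
    have := eq_zero_of_forall_subplaneCoord (F := F) (A := A) (r := ![r, s, -(r * a₀ + s * a₁)])
      (fun u => by
        simp only [Matrix.cons_val_zero, Matrix.cons_val_one, Matrix.cons_val, h₀', h₁', hτ]
        linear_combination frob F (τ u) * hb + frob F (frob F (τ u)) * hc)
    exact ⟨congrFun this 0, congrFun this 1⟩
  have hdet : b₀ * c₁ - b₁ * c₀ ≠ 0 := by
    intro h
    obtain ⟨hb₁, hb₀⟩ := hrow b₁ (-b₀) (by ring) (by linear_combination -h)
    obtain ⟨hc₁, hc₀⟩ := hrow c₁ (-c₀) (by linear_combination h) (by ring)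
    exact one_ne_zero (hrow 1 0 (by simpa using hb₀) (by simpa using hc₀)).1
  -- The terms in `a₀`, `a₁` cancel in the minors. The sign of `c₀`, `c₁` comes from `(s^q t - t^q
  -- s)^(q²) = -(s^(q²) t - t^(q²) s)`.
  let g : (K × K) →ₗ[K] (K × K) :=
    { toFun := fun p => (b₀ * p.1 - c₀ * p.2, b₁ * p.1 - c₁ * p.2)
      map_add' := fun p r => by
        refine Prod.ext ?_ ?_
        · simp only [Prod.fst_add, Prod.snd_add]; ring
        · simp only [Prod.fst_add, Prod.snd_add]; ring
      map_smul' := fun x p => by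
        refine Prod.ext ?_ ?_
        · simp only [Prod.smul_fst, Prod.smul_snd, smul_eq_mul, RingHom.id_apply]; ring
        · simp only [Prod.smul_fst, Prod.smul_snd, smul_eq_mul, RingHom.id_apply]; ring }
  have hg : Function.Injective g := by
    rw [← LinearMap.ker_eq_bot, LinearMap.ker_eq_bot']
    intro p hp
    have e1 : b₀ * p.1 - c₀ * p.2 = 0 := congrArg Prod.fst hp
    have e2 : b₁ * p.1 - c₁ * p.2 = 0 := congrArg Prod.snd hp
    refine Prod.ext ((mul_eq_zero.mp ?_).resolve_left hdet)
      ((mul_eq_zero.mp ?_).resolve_left hdet)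
    · linear_combination c₁ * e1 - c₀ * e2
    · linear_combination b₁ * e1 - b₀ * e2
  refine ⟨τ, LinearEquiv.ofInjectiveEndo g hg, hτ, fun u v => ?_⟩
  rw [LinearEquiv.coe_ofInjectiveEndo]
  simp only [h₀', h₁', g, LinearMap.coe_mk, AddHom.coe_mk, map_sub, map_mul, frob_frob_frob hK]
  refine Prod.ext ?_ ?_
  · ring
  · ring

theorem atInfinity_injective : Function.Injective (atInfinity K) := by
  intro p r h
  exact Prod.ext (congrFun h 0) (congrFun h 1)

omit [Finite F] in
theorem spreadPlane_eq_kLine (ε : (K × K) ≃ₗ[F] (Fin 6 → F)) {L : ℙ K (Fin 3 → K)} {p : K × K}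
    (hp : p ≠ 0) (h : atInfinity K p ∈ L.submodule) : spreadPlane ε L = kLine ε p := by
  have h0 : atInfinity K p ≠ 0 := (map_ne_zero_iff _ atInfinity_injective).mpr hp
  have h1 : L.submodule.comap (atInfinity K) = Submodule.span K {p} := by
    rw [submodule_eq_span h0 h, ← Set.image_singleton, ← Submodule.map_span,
      Submodule.comap_map_eq_of_injective atInfinity_injective]
  rw [spreadPlane, kLine, h1]

/-- The splash of an exterior subplane and the tangent directions in suitable coordinates. -/
theorem exists_normal_form (hK : Module.finrank F K = 3) (ε : (K × K) ≃ₗ[F] (Fin 6 → F))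
    {A : GL (Fin 3) K} (hext : IsExterior (subplane F A)) :
    ∃ (τ : (Fin 3 → F) ≃ₗ[F] K) (e : (K × K) ≃ₗ[F] (Fin 6 → F)),
      splashPlanes ε (subplane F A) = normPlanes e ∧ ∀ u v, ε (tangentDirection A u v) =
        e ((frob F (τ v) * τ u - frob F (τ u) * τ v) / τ u ^ 2,
          frob F (frob F (frob F (τ v) * τ u - frob F (τ u) * τ v)) / τ u ^ 2) := by
  obtain ⟨τ, g, hτ, hg⟩ := exists_subplane_coordinates hK hext
  let e : (K × K) ≃ₗ[F] (Fin 6 → F) := (g.restrictScalars F).trans ε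
  have he (p : K × K) : e p = ε (g p) := rfl
  have hkLine (p : K × K) : kLine e p = kLine ε (g p) := by
    ext v
    simp only [mem_kLine, he, map_smul]
  let w (u v : Fin 3 → F) : K := frob F (τ v) * τ u - frob F (τ u) * τ v
  -- This combination of the two points has last coordinate zero, so it spans the intersection of
  -- their join with the line at infinity.
  have hjoin (u v : Fin 3 → F) : atInfinity K (g (w u v, frob F (frob F (w u v)))) =
      τ u • (A : Matrix (Fin 3) (Fin 3) K).mulVec (extVec K v) -
        τ v • (A : Matrix (Fin 3) (Fin 3) K).mulVec (extVec K u) := by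
    rw [← hg]
    ext i
    simp only [← hτ, subplaneCoord_apply, atInfinity, LinearMap.coe_mk, AddHom.coe_mk,
      Pi.sub_apply, Pi.smul_apply, smul_eq_mul]
    fin_cases i
    · simp [mul_comm]
    · simp [mul_comm]
    · simp [mul_comm]
  have hgne {x : K} (y : K) (hx : x ≠ 0) : g (x, y) ≠ 0 := by
    rw [ne_eq, LinearEquiv.map_eq_zero_iff]
    exact fun h => hx (congrArg Prod.fst h)
  refine ⟨τ, e, ?_, fun u v => ?_⟩
  · ext U
    constructor
    · rintro ⟨L, ⟨hL, P, ⟨u, hu, hP⟩, Q, ⟨v, hv, hQ⟩, -, hLPQ⟩, rfl⟩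
      have hrep : L.rep ∈ L.submodule := by
        rw [Projectivization.submodule_eq]
        exact Submodule.mem_span_singleton_self _
      have hmem := hLPQ hrep
      rw [submodule_eq_span (mulVec_extVec_ne_zero A hu) hP,
        submodule_eq_span (mulVec_extVec_ne_zero A hv) hQ, ← Submodule.span_union,
        Set.singleton_union, Submodule.mem_span_pair] at hmem
      obtain ⟨α, β, hαβ⟩ := hmem
      have h2 := hL _ hrep
      rw [← hαβ, Pi.add_apply, Pi.smul_apply, Pi.smul_apply, ← subplaneCoord_apply,
        ← subplaneCoord_apply, hτ, hτ, smul_eq_mul, smul_eq_mul] at h2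
      have hu0 : τ u ≠ 0 := by rwa [ne_eq, LinearEquiv.map_eq_zero_iff]
      have hα : α = -(β / τ u) * τ v := by
        field_simp
        linear_combination h2
      have hβ : β = β / τ u * τ u := by field_simp
      have hrep2 : L.rep = atInfinity K ((β / τ u) • g (w u v, frob F (frob F (w u v)))) := by
        rw [map_smul, hjoin, ← hαβ, smul_sub, smul_smul, smul_smul, ← hβ, hα]
        module
      have hne : (β / τ u) • g (w u v, frob F (frob F (w u v))) ≠ 0 := by
        intro h
        rw [h, map_zero] at hrep2
        exact L.rep_nonzero hrep2
      have hβ0 : β / τ u ≠ 0 := fun h => hne (by rw [h, zero_smul])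
      have hw0 : w u v ≠ 0 := by
        intro h
        apply hne
        rw [h, map_zero, map_zero, Prod.mk_zero_zero, map_zero, smul_zero]
      rw [hrep2] at hrep
      rw [spreadPlane_eq_kLine ε hne hrep, kLine_smul hβ0, ← hkLine]
      refine ⟨frob F (frob F (w u v)) / w u v, ?_, ?_⟩
      · change cubicNorm F _ = 1
        rw [cubicNorm_div, cubicNorm_frob hK, cubicNorm_frob hK,
          div_self (cubicNorm_ne_zero hw0)]
      · simp only
        rw [← kLine_smul hw0 (1, _)]
        congr 1
        refine Prod.ext (by simp) ?_
        simp only [Prod.smul_snd, smul_eq_mul]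
        field_simp
    · rintro ⟨m, hm, rfl⟩
      -- Every norm 1 slope is realised by two points of the subplane; this gives the inclusion of
      -- the norm family in the splash.
      obtain ⟨s, t, hw0, hwm⟩ := exists_wedge_eq hK hm
      obtain ⟨u, rfl⟩ := τ.surjective t
      obtain ⟨v, rfl⟩ := τ.surjective s
      have hp := hgne (frob F (frob F (w u v))) hw0
      have hq : atInfinity K (g (w u v, frob F (frob F (w u v)))) ≠ 0 :=
        (map_ne_zero_iff _ atInfinity_injective).mpr hp
      have hu : u ≠ 0 := by
        rintro rfl
        simp at hw0
      have hv : v ≠ 0 := by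
        rintro rfl
        simp at hw0
      have hAu := mulVec_extVec_ne_zero A hu
      have hAv := mulVec_extVec_ne_zero A hv
      refine ⟨Projectivization.mk K _ hq, ⟨?_, Projectivization.mk K _ hAu,
        ⟨u, hu, mem_submodule_mk hAu⟩, Projectivization.mk K _ hAv,
        ⟨v, hv, mem_submodule_mk hAv⟩, ?_, ?_⟩, ?_⟩
      · intro x hx
        rw [Projectivization.submodule_mk, Submodule.mem_span_singleton] at hx
        obtain ⟨c, rfl⟩ := hx
        simp [atInfinity]
      · intro h
        rw [Projectivization.mk_eq_mk_iff'] at h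
        obtain ⟨c, hc⟩ := h
        apply hq
        rw [hjoin]
        have h2 := congrFun hc 2
        rw [Pi.smul_apply, ← subplaneCoord_apply, ← subplaneCoord_apply, hτ, hτ,
          smul_eq_mul] at h2
        rw [← hc, ← h2]
        module
      · rw [Projectivization.submodule_mk, Projectivization.submodule_mk,
          Projectivization.submodule_mk, Submodule.span_singleton_le_iff_mem, hjoin,
          ← Submodule.span_union, Set.singleton_union]
        refine Submodule.mem_span_pair.mpr ⟨-τ v, τ u, ?_⟩
        module
      · rw [spreadPlane_eq_kLine ε hp (mem_submodule_mk hq), ← hkLine]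
        simp only
        rw [← kLine_smul hw0 (1, m)]
        congr 1
        refine Prod.ext (by simp) ?_
        simp only [Prod.smul_snd, smul_eq_mul]
        rw [mul_comm]
        exact hwm
  · have h1 : tangentDirection A u v =
        (τ u ^ 2)⁻¹ • g (w u v, frob F (frob F (w u v))) := by
      rw [← hg, ← hτ, ← hτ]
      refine Prod.ext ?_ ?_
      · exact div_eq_inv_mul _ _
      · exact div_eq_inv_mul _ _
    rw [h1, ← map_smul, he]
    congr 2
    refine Prod.ext ?_ ?_
    · exact (div_eq_inv_mul _ _).symm
    · exact (div_eq_inv_mul _ _).symm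

end NormalForm

-- Which of the two covers is tangent.

section TangentCover

variable {F K : Type*} [Field F] [Finite F] [Field K] [Algebra F K]
variable (hK : Module.finrank F K = 3) {e ε : (K × K) ≃ₗ[F] (Fin 6 → F)} {A : GL (Fin 3) K}
  {τ : (Fin 3 → F) ≃ₗ[F] K}

theorem isTangentCover_twist_twist (hS : splashPlanes ε (subplane F A) = normPlanes e)
    (htan : ∀ u v, ε (tangentDirection A u v) =
      e ((frob F (τ v) * τ u - frob F (τ u) * τ v) / τ u ^ 2,
        frob F (frob F (frob F (τ v) * τ u - frob F (τ u) * τ v)) / τ u ^ 2)) :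
    IsTangentCover ε A (normPlanes (twist hK (twist hK e))) := by
  refine ⟨hS ▸ isCover_twist_twist hK e, fun u hu => ?_⟩
  have hu0 : τ u ≠ 0 := by rwa [ne_eq, LinearEquiv.map_eq_zero_iff]
  have hu1 : frob F (τ u) ≠ 0 := frob_ne_zero hu0
  -- In doubly twisted coordinates the tangent direction is `(w / t², w / t^(2q))` with `t = τ u`;
  -- its slope does not involve `v`.
  refine ⟨_, ⟨τ u ^ 2 / frob F (τ u ^ 2), ?_, rfl⟩, fun v => ?_⟩
  · change cubicNorm F _ = 1
    rw [cubicNorm_div, cubicNorm_frob hK, div_self (cubicNorm_ne_zero (pow_ne_zero 2 hu0))]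
  · rw [htan]
    set w := frob F (τ v) * τ u - frob F (τ u) * τ v
    have h1 : e (w / τ u ^ 2, frob F (frob F w) / τ u ^ 2) =
        twist hK (twist hK e) (w / τ u ^ 2, w / frob F (τ u ^ 2)) := by
      rw [twist_apply, twist_apply, map_div₀, map_div₀, frob_frob_frob hK]
    rw [h1, apply_mem_kLine_one, map_pow]
    field_simp

/-- In singly twisted coordinates a common slope at `t` would be an identity in `s`, `s^q`, `s^(q²)`
whose last coefficient `t^q t²` is nonzero. -/
theorem not_isTangentCover_twist
    (htan : ∀ u v, ε (tangentDirection A u v) =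
      e ((frob F (τ v) * τ u - frob F (τ u) * τ v) / τ u ^ 2,
        frob F (frob F (frob F (τ v) * τ u - frob F (τ u) * τ v)) / τ u ^ 2)) :
    ¬ IsTangentCover ε A (normPlanes (twist hK e)) := by
  rintro ⟨-, h⟩
  have hu : (Pi.single 0 1 : Fin 3 → F) ≠ 0 := by simp
  obtain ⟨_, ⟨m, -, rfl⟩, hU⟩ := h _ hu
  set u : Fin 3 → F := Pi.single 0 1
  have hu0 : τ u ≠ 0 := by rwa [ne_eq, LinearEquiv.map_eq_zero_iff]
  have hu1 : frob F (τ u) ≠ 0 := frob_ne_zero hu0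
  have hu2 : frob F (frob F (τ u)) ≠ 0 := frob_ne_zero hu1
  refine mul_ne_zero hu1 (pow_ne_zero 2 hu0) (frob_independent (F := F) hK
    (a := frob F (τ u) * m * frob F (frob F (τ u)) ^ 2)
    (b := -frob F (frob F (τ u)) * τ u ^ 2 - τ u * m * frob F (frob F (τ u)) ^ 2)
    (c := frob F (τ u) * τ u ^ 2) fun s => ?_).2.2
  obtain ⟨v, rfl⟩ := τ.surjective s
  have hv := hU v
  rw [htan] at hv
  have h1 : e ((frob F (τ v) * τ u - frob F (τ u) * τ v) / τ u ^ 2,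
        frob F (frob F (frob F (τ v) * τ u - frob F (τ u) * τ v)) / τ u ^ 2) =
      twist hK e ((frob F (τ v) * τ u - frob F (τ u) * τ v) / τ u ^ 2,
        frob F (frob F (τ v) * τ u - frob F (τ u) * τ v) / frob F (frob F (τ u)) ^ 2) := by
    rw [twist_apply, map_div₀, map_pow, frob_frob_frob hK]
  rw [h1, apply_mem_kLine_one] at hv
  simp only [map_sub, map_mul] at hv
  field_simp at hv
  linear_combination hv

end TangentCover

theorem theorem5p2 {F K : Type*} [Field F] [Finite F] [Field K] [Algebra F K]
    (hK : Module.finrank F K = 3) (ε : (K × K) ≃ₗ[F] (Fin 6 → F)) (A : GL (Fin 3) K)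
    (hext : IsExterior (subplane F A)) :
    (∃! T, IsTangentCover ε A T) ∧ (∃! C, IsConicCover ε A C) ∧
    (∀ T, IsTangentCover ε A T →
      HasExactlyThreeConjTransversals K T ∧ ∃! 𝒮, IsRegularTwoSpread 𝒮 ∧ T ⊆ 𝒮) ∧
    (∀ C, IsConicCover ε A C →
      HasExactlyThreeConjTransversals K C ∧ ∃! 𝒮, IsRegularTwoSpread 𝒮 ∧ C ⊆ 𝒮) := by
  obtain ⟨τ, e, hS, htan⟩ := exists_normal_form hK ε hext
  have hT := isTangentCover_twist_twist hK hS htan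
  have hC := not_isTangentCover_twist hK htan
  have hTiff (X) : IsTangentCover ε A X ↔ X = normPlanes (twist hK (twist hK e)) := by
    constructor
    · intro hX
      have h := hX.1
      rw [hS, isCover_normPlanes_iff hK] at h
      refine h.resolve_left ?_
      rintro rfl
      exact hC hX
    · rintro rfl
      exact hT
  have hCiff (X) : IsConicCover ε A X ↔ X = normPlanes (twist hK e) := by
    constructor
    · rintro ⟨hX, hX'⟩
      rw [hS, isCover_normPlanes_iff hK] at hX
      refine hX.resolve_right ?_
      rintro rfl
      exact hX' hT
    · rintro rfl
      exact ⟨hS ▸ isCover_twist hK e, hC⟩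
  -- Both predicates have become equality with an explicit norm family, so existence and uniqueness
  -- are immediate and the remaining claims concern `normPlanes` alone.
  simp only [hTiff, hCiff, existsUnique_eq, forall_eq, true_and]
  exact ⟨⟨hasExactlyThreeConjTransversals_normPlanes hK _, existsUnique_isRegularTwoSpread hK _⟩,
    ⟨hasExactlyThreeConjTransversals_normPlanes hK _, existsUnique_isRegularTwoSpread hK _⟩⟩
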